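/- Let $p,c>0$, $q<1$, $a,k\in\mathbb{R}$ be constants and let $b\in C^1([0,1]^2)$. Let $b_1\in(-\pi/2,\pi/2)$ be the unique solution in this interval of $\left(\frac{\pi}{2}-b_1\right)\cot\left(\frac{\pi}{2}-b_1\right)=q$, and suppose that $p(\pi-2b_1)^2>4a$. Let $D:=\{u\in H^2(0,1): u(0)=u'(1)-q\,u(1)=0\}$, where elements of $H^2(0,1)$ are identified with their $C^1([0,1])$ representatives. Let $u_{1,0}\in D$ and $u_{2,0}\in C^1([0,1])$, put $$\theta_{1,0}(z):=p\,u_{1,0}''(z)+a\,u_{1,0}(z)+\int_0^1 b(z,s)\,u_{2,0}(s)\,ds,\qquad z\in[0,1],$$ and suppose that $$u_{2,0}(0)=k\,u_{1,0}(1),\qquad \theta_{1,0}\in D,\qquad u_{2,0}'(0)=-c^{-1}k\,\theta_{1,0}(1).$$ Then there exists a unique pair of mappings $u_1\in C^0([0,\infty)\times[0,1])\cap C^1((0,\infty)\times[0,1])$, $u_2\in C^1([0,\infty)\times[0,1])$ with $u_1(t,\cdot)\in C^2([0,1])$ for all $t>0$, such that $$\frac{\partial u_1}{\partial t}(t,z)-p\frac{\partial^2u_1}{\partial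 z^2}(t,z)-a\,u_1(t,z)-\int_0^1 b(z,s)\,u_2(t,s)\,ds=0,\qquad \frac{\partial u_2}{\partial t}(t,z)+c\,\frac{\partial u_2}{\partial z}(t,z)=0$$ for all $(t,z)\in(0,\infty)\times(0,1)$, $$u_1(t,0)=0,\qquad \frac{\partial u_1}{\partial z}(t,1)=q\,u_1(t,1),\qquad u_2(t,0)=k\,u_1(t,1)\qquad\text{for all } t\ge 0,$$ and $u_1(0,z)=u_{1,0}(z)$, $u_2(0,z)=u_{2,0}(z)$ for all $z\in[0,1]$. -/

import Mathlib

open Set MeasureTheory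
open scoped ContDiff

namespace ParabolicTransport

/-- `g` is a weak derivative of order `j` of `f` on the interval `(0,1)`: integration by parts
holds against every smooth function whose support is a compact subset of `(0,1)`. -/
def HasWeakDeriv (j : ℕ) (f g : ℝ → ℝ) : Prop :=
  ∀ φ : ℝ → ℝ, ContDiff ℝ ∞ φ → HasCompactSupport φ → tsupport φ ⊆ Ioo (0 : ℝ) 1 →
    ∫ z in (0 : ℝ)..1, f z * iteratedDeriv j φ z
      = (-1 : ℝ) ^ j * ∫ z in (0 : ℝ)..1, g z * φ z

/-- `f` belongs to `L²(0,1)`. -/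
def MemL2 (f : ℝ → ℝ) : Prop := MemLp f 2 (volume.restrict (Ioo (0 : ℝ) 1))

/-- `f` belongs to the Sobolev space `Hᵏ(0,1)`: it is in `L²(0,1)`, together with all its weak
derivatives up to order `k`. -/
def MemSobolev (k : ℕ) (f : ℝ → ℝ) : Prop :=
  MemL2 f ∧ ∀ j ≤ k, ∃ g : ℝ → ℝ, MemL2 g ∧ HasWeakDeriv j f g

/-- The domain `D = {u ∈ H²(0,1) : u(0) = u'(1) - q u(1) = 0}`. An element of `H²(0,1)` has a
representative of class `C¹` on `[0,1]`, unique on `[0,1]`, and the boundary values are those of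
this representative; the functions in `domainD q` are these representatives (values outside
`[0,1]` are irrelevant). -/
def domainD (q : ℝ) : Set (ℝ → ℝ) :=
  {u | MemSobolev 2 u ∧ ContDiffOn ℝ 1 u (Icc 0 1) ∧
    u 0 = 0 ∧ derivWithin u (Icc 0 1) 1 - q * u 1 = 0}

/-- `(u₁, u₂)` is a classical solution on `[0,∞) × [0,1]` of the loop with initial data
`(u₁₀, u₂₀)`. Only the values `u₁ t z`, `u₂ t z` with `t ≥ 0` and `z ∈ [0,1]` matter. -/
structure IsClassicalSolution (p c q a k : ℝ) (b : ℝ → ℝ → ℝ) (u₁₀ u₂₀ : ℝ → ℝ)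
    (u₁ u₂ : ℝ → ℝ → ℝ) : Prop where
  continuousOn_fst : ContinuousOn (fun x : ℝ × ℝ => u₁ x.1 x.2) (Ici 0 ×ˢ Icc 0 1)
  contDiffOn_fst : ContDiffOn ℝ 1 (fun x : ℝ × ℝ => u₁ x.1 x.2) (Ioi 0 ×ˢ Icc 0 1)
  contDiffOn_profile : ∀ t > 0, ContDiffOn ℝ 2 (u₁ t) (Icc 0 1)
  contDiffOn_snd : ContDiffOn ℝ 1 (fun x : ℝ × ℝ => u₂ x.1 x.2) (Ici 0 ×ˢ Icc 0 1)
  parabolic : ∀ t > 0, ∀ z ∈ Ioo (0 : ℝ) 1,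
    deriv (fun τ => u₁ τ z) t - p * iteratedDeriv 2 (u₁ t) z - a * u₁ t z
      - ∫ s in (0 : ℝ)..1, b z s * u₂ t s = 0
  transport : ∀ t > 0, ∀ z ∈ Ioo (0 : ℝ) 1,
    deriv (fun τ => u₂ τ z) t + c * deriv (u₂ t) z = 0
  boundary_left : ∀ t ≥ 0, u₁ t 0 = 0
  boundary_right : ∀ t ≥ 0, derivWithin (u₁ t) (Icc 0 1) 1 - q * u₁ t 1 = 0
  boundary_loop : ∀ t ≥ 0, u₂ t 0 = k * u₁ t 1
  initial_fst : ∀ z ∈ Icc (0 : ℝ) 1, u₁ 0 z = u₁₀ z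
  initial_snd : ∀ z ∈ Icc (0 : ℝ) 1, u₂ 0 z = u₂₀ z

end ParabolicTransport

/-!
Well-posedness of a heat equation with a Robin condition, coupled in a loop with a transport
equation through its boundary trace and through a distributed source.

*Existence.* The transport equation is solved by `u₂(t,z) = H(t - z/c)`, where the history signal
`H` equals `u₂₀(-c ·)` before time zero and `k u₁(·,1)` afterwards, so the whole loop is governed by
the trace of the parabolic component at `z = 1`. The unknown is taken to be the trace `x` of the
*time derivative* `v = ∂u₁/∂t`, which starts from `θ₁₀`. In the Dirichlet-Neumann sine basis
`sin ((n + 1/2) π z)` the Robin flux `q x` is one more forcing term, and the coefficients of `v` are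
given by Duhamel's formula. The resulting equation for `x` is of Volterra type. It is a contraction
for the norm `sup e^{-κ t} |x(t)|` with `κ` large, since `∑ 1 / (p ωₙ² - a + κ)` is then small
(`exists_trace`). The initial coefficients are summable because `θ₁₀` is in `H²(0,1)`, so `v` is
continuous up to the boundary and up to time zero (`exists_timeDeriv`).

The function `u₁ = u₁₀ + ∫ v` has a continuous time derivative by construction. Its equation,
integrated in time, says that the sine coefficients of `u₁(t,·)` are those of the solution of a
two-point boundary value problem with continuous right-hand side. By completeness of the sine
system the two functions agree (`eq_ellipticSol`, `add_integral_eq_ellipticSol`), which provides the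
second spatial derivative and the Robin condition without differentiating the series. The
compatibility conditions on `u₂₀` make `H` continuously differentiable at time zero.

*Uniqueness.* For the difference of two solutions, the energy `∫ u₁² + ε ∫ u₂²` satisfies a
Gronwall inequality (`IsClassicalSolution.integral_deriv_energy_le`). For small `ε` the boundary
terms are absorbed by the dissipation, as `u₁(t,1)² ≤ ∫ (∂u₁/∂z)²` and `q < 1`.
-/

namespace ParabolicTransport

/-! ### The Dirichlet-Neumann sine basis on the unit interval -/

/-- The `n`-th frequency `(n + 1/2) π` of the Dirichlet-Neumann problem on `[0,1]`. -/
noncomputable def freq (n : ℕ) : ℝ := (n + 1 / 2) * Real.pi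

/-- The `n`-th eigenfunction `sin ((n + 1/2) π z)` of `-d²/dz²` with the conditions `u(0) = 0`,
`u'(1) = 0`. It is not normalised: its square has integral `1/2`. -/
noncomputable def sinMode (n : ℕ) (z : ℝ) : ℝ := Real.sin (freq n * z)

lemma freq_pos (n : ℕ) : 0 < freq n := by
  unfold freq; positivity

lemma sin_freq (n : ℕ) : Real.sin (freq n) = (-1) ^ n := by
  rw [freq, add_mul, show (1 / 2 : ℝ) * Real.pi = Real.pi / 2 by ring, Real.sin_add_pi_div_two,
    Real.cos_nat_mul_pi]

lemma cos_freq (n : ℕ) : Real.cos (freq n) = 0 := by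
  rw [freq, add_mul, show (1 / 2 : ℝ) * Real.pi = Real.pi / 2 by ring, Real.cos_add_pi_div_two,
    Real.sin_nat_mul_pi, neg_zero]

@[simp] lemma sinMode_zero (n : ℕ) : sinMode n 0 = 0 := by simp [sinMode]

@[simp] lemma sinMode_one (n : ℕ) : sinMode n 1 = (-1) ^ n := by simp [sinMode, sin_freq]

@[fun_prop] lemma continuous_sinMode (n : ℕ) : Continuous (sinMode n) := by
  unfold sinMode; fun_prop

lemma abs_sinMode_le (n : ℕ) (z : ℝ) : |sinMode n z| ≤ 1 := Real.abs_sin_le_one _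

lemma sq_le_freq_sq (n : ℕ) : ((n : ℝ) + 1) ^ 2 ≤ freq n ^ 2 := by
  have h : (n : ℝ) + 1 ≤ freq n := by
    unfold freq
    nlinarith [Real.pi_gt_three, (Nat.cast_nonneg n : (0 : ℝ) ≤ n)]
  have : (0 : ℝ) ≤ n := Nat.cast_nonneg n
  nlinarith

lemma summable_inv_freq_sq : Summable fun n : ℕ => 1 / freq n ^ 2 := by
  have h : Summable fun n : ℕ => 1 / ((n : ℝ) + 1) ^ 2 := by
    simpa using (summable_nat_add_iff 1).2 (Real.summable_one_div_nat_pow.2 one_lt_two)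
  refine h.of_nonneg_of_le (fun n => by positivity) fun n => ?_
  exact one_div_le_one_div_of_le (by positivity) (sq_le_freq_sq n)

lemma hasDerivAt_sinMode (n : ℕ) (z : ℝ) :
    HasDerivAt (sinMode n) (freq n * Real.cos (freq n * z)) z := by
  have := (hasDerivAt_const_mul (freq n) (x := z)).sin
  rwa [mul_comm] at this

lemma hasDerivAt_neg_cos_div_freq (n : ℕ) (z : ℝ) :
    HasDerivAt (fun z => -Real.cos (freq n * z) / freq n) (sinMode n z) z := by
  have := ((hasDerivAt_const_mul (freq n) (x := z)).cos.neg.div_const (freq n))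
  rwa [neg_mul, neg_neg, mul_div_cancel_right₀ _ (freq_pos n).ne'] at this

lemma integral_cos_mul {c : ℝ} (hc : c ≠ 0) :
    ∫ z in (0 : ℝ)..1, Real.cos (c * z) = Real.sin c / c := by
  rw [intervalIntegral.integral_comp_mul_left _ hc]; simp [div_eq_inv_mul]

lemma integral_sinMode_mul_sinMode (n m : ℕ) :
    ∫ z in (0 : ℝ)..1, sinMode n z * sinMode m z = if n = m then 1 / 2 else 0 := by
  have hadd : (n + m + 1 : ℝ) * Real.pi ≠ 0 := by positivity
  have h2 : ∫ z in (0 : ℝ)..1, Real.cos (((n + m + 1 : ℝ) * Real.pi) * z) = 0 := by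
    rw [integral_cos_mul hadd]
    have := Real.sin_nat_mul_pi (n + m + 1)
    push_cast at this
    rw [this, zero_div]
  have h1 : ∫ z in (0 : ℝ)..1, Real.cos (((n - m : ℝ) * Real.pi) * z) =
      if n = m then 1 else 0 := by
    split_ifs with h
    · subst h; simp
    · have : (n - m : ℝ) * Real.pi ≠ 0 :=
        mul_ne_zero (sub_ne_zero.2 (by exact_mod_cast h)) Real.pi_ne_zero
      rw [integral_cos_mul this]
      have := Real.sin_int_mul_pi (n - m)
      push_cast at this
      rw [this, zero_div]
  have hpt : ∀ z, sinMode n z * sinMode m z =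
      (1 / 2) * (Real.cos (((n - m : ℝ) * Real.pi) * z) -
        Real.cos (((n + m + 1 : ℝ) * Real.pi) * z)) := by
    intro z
    have e1 : ((n - m : ℝ) * Real.pi) * z = freq n * z - freq m * z := by unfold freq; ring
    have e2 : ((n + m + 1 : ℝ) * Real.pi) * z = freq n * z + freq m * z := by unfold freq; ring
    rw [e1, e2, Real.cos_sub, Real.cos_add, sinMode, sinMode]; ring
  simp_rw [hpt]
  rw [intervalIntegral.integral_const_mul, intervalIntegral.integral_sub
    (by apply Continuous.intervalIntegrable; fun_prop)
    (by apply Continuous.intervalIntegrable; fun_prop), h1, h2]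
  split_ifs <;> norm_num

/-- A continuous nonnegative function on `[0,1]` with integral zero vanishes on `[0,1]`. -/
lemma eq_zero_of_integral_eq_zero {f : ℝ → ℝ} (hf : ContinuousOn f (Icc 0 1))
    (h0 : ∀ z ∈ Icc (0 : ℝ) 1, 0 ≤ f z) (hI : ∫ z in (0 : ℝ)..1, f z ≤ 0) :
    ∀ z ∈ Icc (0 : ℝ) 1, f z = 0 := by
  intro z hz
  by_contra hne
  have hpos : 0 < ∫ z in (0 : ℝ)..1, f z :=
    intervalIntegral.integral_pos zero_lt_one hf (fun x hx => h0 x (Ioc_subset_Icc_self hx))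
      ⟨z, hz, lt_of_le_of_ne (h0 z hz) (Ne.symm hne)⟩
  linarith

/-- A continuous function whose cosine moments on `[0,1]` all vanish is zero there: it is
orthogonal to every polynomial in `cos (π z)`, hence, by Weierstrass, to itself. -/
lemma eq_zero_of_integral_mul_cos {W : ℝ → ℝ} (hW : Continuous W)
    (h : ∀ m : ℕ, ∫ z in (0 : ℝ)..1, W z * Real.cos (m * (Real.pi * z)) = 0) :
    ∀ z ∈ Icc (0 : ℝ) 1, W z = 0 := by
  have hpow : ∀ j m : ℕ, ∫ z in (0 : ℝ)..1,
      W z * Real.cos (Real.pi * z) ^ j * Real.cos (m * (Real.pi * z)) = 0 := by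
    intro j
    induction j with
    | zero => intro m; simpa using h m
    | succ j ih =>
      intro m
      rcases m with _ | m
      · have := ih 1
        simp only [Nat.cast_one, one_mul] at this
        simpa [pow_succ, mul_assoc] using this
      · have hpt : ∀ z, W z * Real.cos (Real.pi * z) ^ (j + 1)
            * Real.cos ((m + 1 : ℕ) * (Real.pi * z)) =
            (1 / 2) * (W z * Real.cos (Real.pi * z) ^ j * Real.cos ((m + 2 : ℕ) * (Real.pi * z))
            + W z * Real.cos (Real.pi * z) ^ j * Real.cos (m * (Real.pi * z))) := by
          intro z
          have e1 : ((m + 2 : ℕ) : ℝ) * (Real.pi * z)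
              = (m + 1 : ℕ) * (Real.pi * z) + Real.pi * z := by push_cast; ring
          have e2 : (m : ℝ) * (Real.pi * z)
              = (m + 1 : ℕ) * (Real.pi * z) - Real.pi * z := by push_cast; ring
          rw [e1, e2, Real.cos_sub, Real.cos_add]; ring
        simp_rw [hpt]
        rw [intervalIntegral.integral_const_mul, intervalIntegral.integral_add
          (by apply Continuous.intervalIntegrable; fun_prop)
          (by apply Continuous.intervalIntegrable; fun_prop), ih, ih]
        simp
  have hpoly : ∀ P : Polynomial ℝ,
      ∫ z in (0 : ℝ)..1, W z * P.eval (Real.cos (Real.pi * z)) = 0 := by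
    intro P
    induction P using Polynomial.induction_on' with
    | add P Q hP hQ =>
      simp_rw [Polynomial.eval_add, mul_add]
      rw [intervalIntegral.integral_add (by apply Continuous.intervalIntegrable; fun_prop)
          (by apply Continuous.intervalIntegrable; fun_prop), hP, hQ, add_zero]
    | monomial j r =>
      have := hpow j 0
      simp only [Nat.cast_zero, zero_mul, Real.cos_zero, mul_one] at this
      simp_rw [Polynomial.eval_monomial, mul_left_comm _ r]
      rw [intervalIntegral.integral_const_mul, this, mul_zero]
  have harc : ∀ z ∈ Icc (0 : ℝ) 1, Real.arccos (Real.cos (Real.pi * z)) / Real.pi = z := by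
    intro z hz
    rw [Real.arccos_cos (by have := hz.1; positivity) (by nlinarith [hz.2, Real.pi_pos])]
    field_simp
  set A : ℝ := ∫ z in (0 : ℝ)..1, |W z|
  have hA : 0 ≤ A := intervalIntegral.integral_nonneg zero_le_one fun _ _ => abs_nonneg _
  have hsq : ∀ ε > 0, ∫ z in (0 : ℝ)..1, W z * W z ≤ ε * A := by
    intro ε hε
    obtain ⟨P, hP⟩ := exists_polynomial_near_of_continuousOn (-1) 1
      (fun y => W (Real.arccos y / Real.pi))
      ((hW.comp (Real.continuous_arccos.div_const _)).continuousOn) ε hε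
    have : ∫ z in (0 : ℝ)..1, W z * W z
        = ∫ z in (0 : ℝ)..1, (W z * W z - W z * P.eval (Real.cos (Real.pi * z))) := by
      rw [intervalIntegral.integral_sub (by apply Continuous.intervalIntegrable; fun_prop)
          (by apply Continuous.intervalIntegrable; fun_prop), hpoly, sub_zero]
    rw [this, ← intervalIntegral.integral_const_mul]
    refine intervalIntegral.integral_mono_on zero_le_one
      (by apply Continuous.intervalIntegrable; fun_prop)
      (by apply Continuous.intervalIntegrable; fun_prop) fun z hz => ?_
    have hz' := hP (Real.cos (Real.pi * z)) (Real.cos_mem_Icc _)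
    simp only [harc z hz] at hz'
    calc W z * W z - W z * P.eval (Real.cos (Real.pi * z))
        ≤ |W z * (W z - P.eval (Real.cos (Real.pi * z)))| := by
          rw [← mul_sub]; exact le_abs_self _
      _ = |P.eval (Real.cos (Real.pi * z)) - W z| * |W z| := by
          rw [abs_mul, abs_sub_comm, mul_comm]
      _ ≤ ε * |W z| := by gcongr
  have hle : ∫ z in (0 : ℝ)..1, W z * W z ≤ 0 := by
    refine le_of_forall_pos_le_add fun δ hδ => ?_
    refine (hsq (δ / (A + 1)) (by positivity)).trans ?_
    rw [zero_add, div_mul_eq_mul_div, div_le_iff₀ (by positivity)]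
    nlinarith
  intro z hz
  exact mul_self_eq_zero.1 (eq_zero_of_integral_eq_zero (f := fun z => W z * W z)
    (by fun_prop) (fun z _ => mul_self_nonneg _) hle z hz)

/-- Completeness of the sine basis. Multiplication by `sin (π z / 2)` turns vanishing sine
coefficients into vanishing cosine moments. -/
lemma eq_zero_of_integral_mul_sinMode {w : ℝ → ℝ} (hw : Continuous w)
    (h : ∀ n : ℕ, ∫ z in (0 : ℝ)..1, w z * sinMode n z = 0) :
    ∀ z ∈ Icc (0 : ℝ) 1, w z = 0 := by
  have hcos : ∀ m : ℕ, ∫ z in (0 : ℝ)..1,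
      (w z * Real.sin (Real.pi / 2 * z)) * Real.cos (m * (Real.pi * z)) = 0 := by
    intro m
    rcases m with _ | m
    · have := h 0
      simp only [sinMode, freq, Nat.cast_zero, zero_add] at this
      simpa [show Real.pi / 2 = 1 / 2 * Real.pi by ring] using this
    · have hpt : ∀ z, (w z * Real.sin (Real.pi / 2 * z)) * Real.cos ((m + 1 : ℕ) * (Real.pi * z))
          = (1 / 2) * (w z * sinMode (m + 1) z - w z * sinMode m z) := by
        intro z
        have e1 : freq (m + 1) * z = (m + 1 : ℕ) * (Real.pi * z) + Real.pi / 2 * z := by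
          unfold freq; push_cast; ring
        have e2 : freq m * z = (m + 1 : ℕ) * (Real.pi * z) - Real.pi / 2 * z := by
          unfold freq; push_cast; ring
        rw [sinMode, sinMode, e1, e2, Real.sin_sub, Real.sin_add]; ring
      simp_rw [hpt]
      rw [intervalIntegral.integral_const_mul, intervalIntegral.integral_sub
          (by apply Continuous.intervalIntegrable; fun_prop)
          (by apply Continuous.intervalIntegrable; fun_prop), h, h]
      simp
  have hW := eq_zero_of_integral_mul_cos (W := fun z => w z * Real.sin (Real.pi / 2 * z))
    (by fun_prop) hcos
  have hIoo : EqOn w 0 (Ioc 0 1) := by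
    intro z hz
    have hs : 0 < Real.sin (Real.pi / 2 * z) :=
      Real.sin_pos_of_pos_of_lt_pi (by have := hz.1; positivity)
        (by nlinarith [hz.2, Real.pi_pos])
    exact (mul_eq_zero.1 (hW z (Ioc_subset_Icc_self hz))).resolve_right hs.ne'
  have := hIoo.closure hw continuous_zero
  rw [closure_Ioc zero_ne_one] at this
  exact this

/-- The function with `W'' = -h`, `W(0) = 0`, `W'(1) = r`. -/
noncomputable def ellipticSol (h : ℝ → ℝ) (r z : ℝ) : ℝ :=
  ∫ s in (0 : ℝ)..z, (r + ∫ σ in s..1, h σ)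

lemma hasDerivAt_integral_to_one {h : ℝ → ℝ} (hh : Continuous h) (s : ℝ) :
    HasDerivAt (fun s => ∫ σ in s..1, h σ) (-h s) s :=
  intervalIntegral.integral_hasDerivAt_left (hh.intervalIntegrable _ _)
    (hh.stronglyMeasurableAtFilter _ _) hh.continuousAt

@[fun_prop] lemma continuous_integral_to_one {h : ℝ → ℝ} (hh : Continuous h) :
    Continuous (fun s => ∫ σ in s..1, h σ) :=
  continuous_iff_continuousAt.2 fun s => (hasDerivAt_integral_to_one hh s).continuousAt

lemma hasDerivAt_ellipticSol {h : ℝ → ℝ} (hh : Continuous h) (r z : ℝ) :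
    HasDerivAt (ellipticSol h r) (r + ∫ σ in z..1, h σ) z :=
  (by fun_prop : Continuous fun s => r + ∫ σ in s..1, h σ).integral_hasStrictDerivAt 0 z
    |>.hasDerivAt

lemma continuous_ellipticSol {h : ℝ → ℝ} (hh : Continuous h) (r : ℝ) :
    Continuous (ellipticSol h r) :=
  continuous_iff_continuousAt.2 fun z => (hasDerivAt_ellipticSol hh r z).continuousAt

lemma freq_sq_mul_integral_ellipticSol {h : ℝ → ℝ} (hh : Continuous h) (r : ℝ) (n : ℕ) :
    freq n ^ 2 * ∫ z in (0 : ℝ)..1, ellipticSol h r z * sinMode n z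
      = (∫ z in (0 : ℝ)..1, h z * sinMode n z) + r * (-1) ^ n := by
  have hω := (freq_pos n).ne'
  have p1 := intervalIntegral.integral_mul_deriv_eq_deriv_mul (a := 0) (b := 1)
    (fun z _ => hasDerivAt_ellipticSol hh r z) (fun z _ => hasDerivAt_neg_cos_div_freq n z)
    (by apply Continuous.intervalIntegrable; fun_prop)
    (by apply Continuous.intervalIntegrable; fun_prop)
  have p2 := intervalIntegral.integral_mul_deriv_eq_deriv_mul (a := 0) (b := 1)
    (fun z _ => (hasDerivAt_integral_to_one hh z).const_add r)
    (fun z _ => hasDerivAt_sinMode n z)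
    (by apply Continuous.intervalIntegrable; fun_prop)
    (by apply Continuous.intervalIntegrable; fun_prop)
  have z0 : ellipticSol h r 0 = 0 := by simp [ellipticSol]
  have e : ∀ z, (r + ∫ σ in z..1, h σ) * (-Real.cos (freq n * z) / freq n)
      = -(1 / freq n ^ 2) * ((r + ∫ σ in z..1, h σ) * (freq n * Real.cos (freq n * z))) := by
    intro z; field_simp
  simp_rw [e] at p1
  rw [intervalIntegral.integral_const_mul, p2] at p1
  rw [p1]
  simp only [mul_one, cos_freq, z0, sinMode_one, sinMode_zero, intervalIntegral.integral_same,
    neg_mul, intervalIntegral.integral_neg]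
  field_simp
  ring

/-- A continuous function is identified as the solution of a two-point boundary value problem by
its sine coefficients. -/
lemma eq_ellipticSol {w h : ℝ → ℝ} (hw : Continuous w) (hh : Continuous h) (r : ℝ)
    (H : ∀ n : ℕ, freq n ^ 2 * ∫ z in (0 : ℝ)..1, w z * sinMode n z
      = (∫ z in (0 : ℝ)..1, h z * sinMode n z) + r * (-1) ^ n) :
    ∀ z ∈ Icc (0 : ℝ) 1, w z = ellipticSol h r z := by
  have hW := continuous_ellipticSol hh r
  have := eq_zero_of_integral_mul_sinMode (w := fun z => w z - ellipticSol h r z)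
    (hw.sub hW) (fun n => by
      simp_rw [sub_mul]
      rw [intervalIntegral.integral_sub (by apply Continuous.intervalIntegrable; fun_prop)
          (by apply Continuous.intervalIntegrable; fun_prop), sub_eq_zero]
      have := (H n).trans (freq_sq_mul_integral_ellipticSol hh r n).symm
      exact mul_left_cancel₀ (pow_ne_zero 2 (freq_pos n).ne') this)
  intro z hz
  exact sub_eq_zero.1 (this z hz)

/-! ### Weak second derivatives -/

lemma MemL2.intervalIntegrable {g : ℝ → ℝ} (hg : MemL2 g) :
    IntervalIntegrable g volume 0 1 := by
  rw [intervalIntegrable_iff_integrableOn_Ioo_of_le zero_le_one]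
  exact MemLp.integrable one_le_two hg

lemma integral_primitive_mul_deriv {g φ : ℝ → ℝ} (hg : IntervalIntegrable g volume 0 1)
    (hφ : ContDiff ℝ 1 φ) :
    ∫ z in (0 : ℝ)..1, (∫ s in (0 : ℝ)..z, g s) * deriv φ z
      = (∫ s in (0 : ℝ)..1, g s) * φ 1 - ∫ z in (0 : ℝ)..1, g z * φ z := by
  have hΓ := hg.absolutelyContinuousOnInterval_intervalIntegral (c := 0) (by simp)
  have hφ' : AbsolutelyContinuousOnInterval φ 0 1 := by
    obtain ⟨K, hK⟩ := hφ.contDiffOn.exists_lipschitzOnWith (s := Icc (0 : ℝ) 1) one_ne_zero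
      (convex_Icc 0 1) isCompact_Icc
    exact LipschitzOnWith.absolutelyContinuousOnInterval (by rwa [uIcc_of_le zero_le_one])
  rw [hΓ.integral_mul_deriv_eq_deriv_mul hφ']
  have : ∫ z in (0 : ℝ)..1, deriv (fun z => ∫ s in (0 : ℝ)..z, g s) z * φ z
      = ∫ z in (0 : ℝ)..1, g z * φ z := by
    apply intervalIntegral.integral_congr_ae
    filter_upwards [hg.ae_hasDerivAt_integral] with z hz hz'
    rw [(hz (uIoc_subset_uIcc hz') 0 (by simp)).deriv]
  rw [this]
  simp

/-- The lemma of du Bois-Reymond: a continuous function orthogonal to the derivatives of all test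
functions on `(0,1)` is constant. -/
lemma exists_eq_const_of_integral_mul_deriv {ψ : ℝ → ℝ} (hψ : ContinuousOn ψ (Icc 0 1))
    (h : ∀ φ : ℝ → ℝ, ContDiff ℝ ∞ φ → HasCompactSupport φ → tsupport φ ⊆ Ioo (0 : ℝ) 1 →
      ∫ z in (0 : ℝ)..1, ψ z * deriv φ z = 0) :
    ∃ C, ∀ z ∈ Icc (0 : ℝ) 1, ψ z = C := by
  let B : ContDiffBump (1 / 2 : ℝ) := ⟨1 / 8, 1 / 4, by norm_num, by norm_num⟩
  set η : ℝ → ℝ := B.normed volume with hη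
  have hηd : ContDiff ℝ ∞ η := B.contDiff_normed
  have hηs : tsupport η ⊆ Ioo 0 1 := by
    rw [hη, B.tsupport_normed_eq, Real.closedBall_eq_Icc]
    intro z hz
    exact ⟨lt_of_lt_of_le (by norm_num) hz.1, lt_of_le_of_lt hz.2 (by norm_num)⟩
  have hηc : HasCompactSupport η := B.hasCompactSupport_normed
  have hsupp : ∀ {f : ℝ → ℝ}, tsupport f ⊆ Ioo 0 1 → ∀ F : ℝ → ℝ,
      ∫ z in (0 : ℝ)..1, F z * f z = ∫ z, F z * f z := by
    intro f hf F
    refine intervalIntegral.integral_eq_integral_of_support_subset fun z hz => ?_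
    exact Ioo_subset_Ioc_self (hf (subset_tsupport _ (right_ne_zero_of_mul hz)))
  have hη1 : ∫ z in (0 : ℝ)..1, η z = 1 := by
    have := hsupp hηs (fun _ => 1)
    simp only [one_mul] at this
    rw [this, hη, B.integral_normed]
  set m := ∫ z in (0 : ℝ)..1, ψ z * η z with hm
  have hψI : IntervalIntegrable ψ volume 0 1 :=
    ContinuousOn.intervalIntegrable (by rwa [uIcc_of_le zero_le_one])
  have key : ∀ χ : ℝ → ℝ, ContDiff ℝ ∞ χ → HasCompactSupport χ → tsupport χ ⊆ Ioo (0 : ℝ) 1 →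
      ∫ z in (0 : ℝ)..1, (ψ z - m) * χ z = 0 := by
    intro χ hχd hχc hχs
    set C := ∫ z in (0 : ℝ)..1, χ z with hC
    set ζ : ℝ → ℝ := fun z => χ z - C * η z with hζ
    have hζd : ContDiff ℝ ∞ ζ := hχd.sub (contDiff_const.mul hηd)
    have hζ0 : ∫ z in (0 : ℝ)..1, ζ z = 0 := by
      rw [hζ, intervalIntegral.integral_sub (hχd.continuous.intervalIntegrable _ _)
        ((hηd.continuous.const_mul C).intervalIntegrable _ _),
        intervalIntegral.integral_const_mul, hη1, ← hC]
      ring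
    set K : Set ℝ := insert (1 / 2) (tsupport χ ∪ tsupport η)
    have hKc : IsCompact K := (hχc.isCompact.union hηc.isCompact).insert _
    have hKs : K ⊆ Ioo 0 1 :=
      insert_subset (by norm_num) (union_subset hχs hηs)
    obtain ⟨α, hαK, hα⟩ := hKc.exists_isLeast ⟨_, mem_insert _ _⟩
    obtain ⟨β, hβK, hβ⟩ := hKc.exists_isGreatest ⟨_, mem_insert _ _⟩
    have hζK : ∀ z, z ∉ K → ζ z = 0 := by
      intro z hz
      have h1 : χ z = 0 := image_eq_zero_of_notMem_tsupport fun h' =>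
        hz (mem_insert_of_mem _ (Or.inl h'))
      have h2 : η z = 0 := image_eq_zero_of_notMem_tsupport fun h' =>
        hz (mem_insert_of_mem _ (Or.inr h'))
      simp [hζ, h1, h2]
    set φ : ℝ → ℝ := fun z => ∫ s in (0 : ℝ)..z, ζ s
    have hφ' : ∀ z, HasDerivAt φ (ζ z) z := fun z =>
      (hζd.continuous.integral_hasStrictDerivAt 0 z).hasDerivAt
    have hdφ : deriv φ = ζ := funext fun z => (hφ' z).deriv
    have hφd : ContDiff ℝ ∞ φ :=
      contDiff_infty_iff_deriv.2 ⟨fun z => (hφ' z).differentiableAt, hdφ ▸ hζd⟩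
    have hφs : tsupport φ ⊆ Icc α β := by
      refine closure_minimal (fun z hz => ?_) isClosed_Icc
      by_contra hcon
      refine hz ?_
      rw [mem_Icc, not_and_or, not_le, not_le] at hcon
      rcases hcon with hcon | hcon
      · refine intervalIntegral.integral_zero_ae (Filter.Eventually.of_forall fun s hs => ?_)
        refine hζK s fun hsK => ?_
        have h1 := hα hsK
        have h2 := (hKs hαK).1
        rcases le_total 0 z with h0 | h0
        · rw [uIoc_of_le h0] at hs; linarith [hs.2]
        · rw [uIoc_of_ge h0] at hs; linarith [hs.2]
      · have h3 : φ z = (∫ s in (0 : ℝ)..1, ζ s) + ∫ s in (1 : ℝ)..z, ζ s :=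
          (intervalIntegral.integral_add_adjacent_intervals
            (hζd.continuous.intervalIntegrable _ _) (hζd.continuous.intervalIntegrable _ _)).symm
        rw [h3, hζ0, zero_add]
        refine intervalIntegral.integral_zero_ae (Filter.Eventually.of_forall fun s hs => ?_)
        refine hζK s fun hsK => ?_
        have h1 := hβ hsK
        have h2 := (hKs hβK).2
        rcases le_total 1 z with h0 | h0
        · rw [uIoc_of_le h0] at hs; linarith [hs.1]
        · rw [uIoc_of_ge h0] at hs; linarith [hs.1]
    have hres := h φ hφd (HasCompactSupport.intro' isCompact_Icc isClosed_Icc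
      fun z hz => image_eq_zero_of_notMem_tsupport fun h' => hz (hφs h'))
      (hφs.trans fun z hz => ⟨(hKs hαK).1.trans_le hz.1, hz.2.trans_lt (hKs hβK).2⟩)
    have hc1 : IntervalIntegrable (fun z => ψ z * χ z) volume 0 1 :=
      hψI.mul_continuousOn hχd.continuous.continuousOn
    have hc2 : IntervalIntegrable (fun z => ψ z * η z) volume 0 1 :=
      hψI.mul_continuousOn hηd.continuous.continuousOn
    have e1 : ∀ z, ψ z * deriv φ z = ψ z * χ z - C * (ψ z * η z) := by
      intro z; rw [hdφ, hζ]; ring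
    simp_rw [e1] at hres
    rw [intervalIntegral.integral_sub hc1 (hc2.const_mul C),
      intervalIntegral.integral_const_mul, ← hm] at hres
    simp_rw [sub_mul]
    rw [intervalIntegral.integral_sub hc1 ((hχd.continuous.intervalIntegrable _ _).const_mul m),
      intervalIntegral.integral_const_mul, ← hC]
    linarith
  refine ⟨m, ?_⟩
  have hae := isOpen_Ioo.ae_eq_zero_of_integral_contDiff_smul_eq_zero (μ := volume)
    (f := fun z => ψ z - m) (U := Ioo (0 : ℝ) 1)
    (((hψ.mono Ioo_subset_Icc_self).sub continuousOn_const).locallyIntegrableOn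
      measurableSet_Ioo)
    (fun χ h1 h2 h3 => by
      have := key χ h1 h2 h3
      rw [hsupp h3] at this
      simpa [mul_comm] using this)
  have hae' : ψ =ᵐ[volume.restrict (Icc 0 1)] fun _ => m := by
    rw [restrict_Ioo_eq_restrict_Icc.symm]
    refine (ae_restrict_iff' measurableSet_Ioo).2 ?_
    filter_upwards [hae] with z hz hz'
    exact sub_eq_zero.1 (hz hz')
  exact Measure.eqOn_Icc_of_ae_eq volume zero_ne_one hae' hψ continuousOn_const

lemma hasDerivWithinAt_of_contDiffOn {f : ℝ → ℝ} (hf : ContDiffOn ℝ 1 f (Icc 0 1)) {z : ℝ}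
    (hz : z ∈ Icc (0 : ℝ) 1) :
    HasDerivWithinAt f (derivWithin f (Icc 0 1) z) (Icc 0 1) z :=
  (hf.differentiableOn one_ne_zero z hz).hasDerivWithinAt

lemma continuousOn_derivWithin {f : ℝ → ℝ} (hf : ContDiffOn ℝ 1 f (Icc 0 1)) :
    ContinuousOn (derivWithin f (Icc 0 1)) (Icc 0 1) :=
  hf.continuousOn_derivWithin (uniqueDiffOn_Icc zero_lt_one) le_rfl

/-- If a `C¹` function has a weak second derivative in `L²(0,1)`, then its derivative is a
primitive of the latter. -/
lemma HasWeakDeriv.derivWithin_eq {f g : ℝ → ℝ} (hf : ContDiffOn ℝ 1 f (Icc 0 1))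
    (hg : MemL2 g) (h : HasWeakDeriv 2 f g) :
    ∀ z ∈ Icc (0 : ℝ) 1,
      derivWithin f (Icc 0 1) z = derivWithin f (Icc 0 1) 0 + ∫ s in (0 : ℝ)..z, g s := by
  have hgI := hg.intervalIntegrable
  have hf' := continuousOn_derivWithin hf
  have hΓ : ContinuousOn (fun z => ∫ s in (0 : ℝ)..z, g s) (Icc 0 1) := by
    have := intervalIntegral.continuousOn_primitive_interval' hgI (a := 0) (by simp)
    rwa [uIcc_of_le zero_le_one] at this
  obtain ⟨C, hC⟩ := exists_eq_const_of_integral_mul_deriv (hf'.sub hΓ) (by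
    intro φ hφ hφc hφs
    have h1 : φ 1 = 0 := image_eq_zero_of_notMem_tsupport fun h' => (hφs h').2.ne rfl
    have hφ1 : ContDiff ℝ 1 φ := hφ.of_le (by exact_mod_cast le_top)
    have hφ2 : ContDiff ℝ 1 (deriv φ) :=
      (contDiff_infty_iff_deriv.1 hφ).2.of_le (by exact_mod_cast le_top)
    have d0 : deriv φ 0 = 0 := image_eq_zero_of_notMem_tsupport fun h' =>
      (hφs (tsupport_deriv_subset h')).1.ne rfl
    have d1 : deriv φ 1 = 0 := image_eq_zero_of_notMem_tsupport fun h' =>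
      (hφs (tsupport_deriv_subset h')).2.ne rfl
    have A := integral_primitive_mul_deriv hgI hφ1
    have H := h φ hφ hφc hφs
    rw [h1, mul_zero, zero_sub] at A
    have hit : iteratedDeriv 2 φ = deriv (deriv φ) := by
      rw [iteratedDeriv_succ, iteratedDeriv_one]
    have B := intervalIntegral.integral_mul_deriv_eq_deriv_mul_of_hasDerivWithinAt
      (a := 0) (b := 1) (u := f) (v := deriv φ) (u' := derivWithin f (Icc 0 1))
      (v' := deriv (deriv φ))
      (by rw [uIcc_of_le zero_le_one]; exact fun z hz => hasDerivWithinAt_of_contDiffOn hf hz)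
      (fun z _ => (hφ2.differentiable one_ne_zero z).hasDerivAt.hasDerivWithinAt)
      (ContinuousOn.intervalIntegrable (by rwa [uIcc_of_le zero_le_one]))
      ((hφ2.continuous_deriv le_rfl).intervalIntegrable _ _)
    rw [hit, B, d0, d1] at H
    simp only [Pi.sub_apply, sub_mul]
    rw [intervalIntegral.integral_sub, A]
    · linarith
    · exact ContinuousOn.intervalIntegrable (by
        rw [uIcc_of_le zero_le_one]; exact hf'.mul hφ2.continuous.continuousOn)
    · exact ContinuousOn.intervalIntegrable (by
        rw [uIcc_of_le zero_le_one]; exact hΓ.mul hφ2.continuous.continuousOn))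
  intro z hz
  have e1 := hC z hz
  have e0 := hC 0 (by simp)
  simp only [Pi.sub_apply, intervalIntegral.integral_same, sub_zero] at e0 e1
  linarith

lemma freq_sq_mul_integral_mul_sinMode {f g : ℝ → ℝ} (hf : ContDiffOn ℝ 1 f (Icc 0 1))
    (hg : MemL2 g) (h : HasWeakDeriv 2 f g) (h0 : f 0 = 0) (n : ℕ) :
    freq n ^ 2 * ∫ z in (0 : ℝ)..1, f z * sinMode n z
      = derivWithin f (Icc 0 1) 1 * (-1) ^ n - ∫ z in (0 : ℝ)..1, g z * sinMode n z := by
  have hω := (freq_pos n).ne'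
  have hgI := hg.intervalIntegrable
  have hf' := continuousOn_derivWithin hf
  have hds : deriv (sinMode n) = fun z => freq n * Real.cos (freq n * z) :=
    funext fun z => (hasDerivAt_sinMode n z).deriv
  have hs : ContDiff ℝ 1 (sinMode n) := by unfold sinMode; fun_prop
  have p1 := intervalIntegral.integral_mul_deriv_eq_deriv_mul_of_hasDerivWithinAt
      (a := 0) (b := 1) (u := f) (u' := derivWithin f (Icc 0 1))
      (by rw [uIcc_of_le zero_le_one]; exact fun z hz => hasDerivWithinAt_of_contDiffOn hf hz)
      (fun z _ => (hasDerivAt_neg_cos_div_freq n z).hasDerivWithinAt)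
      (ContinuousOn.intervalIntegrable (by rwa [uIcc_of_le zero_le_one]))
      (by apply Continuous.intervalIntegrable; fun_prop)
  have p2 := integral_primitive_mul_deriv hgI hs
  have p3 : ∫ z in (0 : ℝ)..1, derivWithin f (Icc 0 1) z * deriv (sinMode n) z
      = derivWithin f (Icc 0 1) 1 * (-1) ^ n - ∫ z in (0 : ℝ)..1, g z * sinMode n z := by
    have hΓ : ContinuousOn (fun z => ∫ s in (0 : ℝ)..z, g s) (uIcc 0 1) :=
      intervalIntegral.continuousOn_primitive_interval' hgI (a := 0) (by simp)
    have hdc : Continuous (deriv (sinMode n)) := hs.continuous_deriv le_rfl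
    have e : ∫ z in (0 : ℝ)..1, derivWithin f (Icc 0 1) z * deriv (sinMode n) z
        = ∫ z in (0 : ℝ)..1, (derivWithin f (Icc 0 1) 0 * deriv (sinMode n) z
          + (∫ s in (0 : ℝ)..z, g s) * deriv (sinMode n) z) := by
      apply intervalIntegral.integral_congr
      rw [uIcc_of_le zero_le_one]
      intro z hz
      simp only [h.derivWithin_eq hf hg z hz, add_mul]
    have hI : IntervalIntegrable (fun z => (∫ s in (0 : ℝ)..z, g s) * deriv (sinMode n) z)
        volume 0 1 := ContinuousOn.intervalIntegrable (hΓ.mul hdc.continuousOn)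
    rw [e, intervalIntegral.integral_add ((hdc.intervalIntegrable _ _).const_mul _) hI, p2,
      intervalIntegral.integral_const_mul, intervalIntegral.integral_deriv_eq_sub
        (fun z _ => (hasDerivAt_sinMode n z).differentiableAt) (hdc.intervalIntegrable _ _),
      h.derivWithin_eq hf hg 1 (by simp)]
    simp
    ring
  have e : ∀ z, derivWithin f (Icc 0 1) z * (-Real.cos (freq n * z) / freq n)
      = -(1 / freq n ^ 2) * (derivWithin f (Icc 0 1) z * deriv (sinMode n) z) := by
    intro z; rw [hds]; field_simp
  simp_rw [e] at p1
  rw [intervalIntegral.integral_const_mul, p3] at p1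
  rw [p1]
  simp only [mul_one, cos_freq, h0]
  field_simp
  ring

/-! ### A Volterra equation for a boundary trace -/

/-- The solution of `y' = -μ y + r`, `y(0) = θ`, in Duhamel's form. -/
noncomputable def duhamel (μ θ : ℝ) (r : ℝ → ℝ) (t : ℝ) : ℝ :=
  Real.exp (-μ * t) * (θ + ∫ s in (0 : ℝ)..t, Real.exp (μ * s) * r s)

lemma duhamel_zero (μ θ : ℝ) (r : ℝ → ℝ) : duhamel μ θ r 0 = θ := by simp [duhamel]

lemma hasDerivAt_duhamel (μ θ : ℝ) {r : ℝ → ℝ} (hr : Continuous r) (t : ℝ) :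
    HasDerivAt (duhamel μ θ r) (-μ * duhamel μ θ r t + r t) t := by
  have h1 : HasDerivAt (fun t => ∫ s in (0 : ℝ)..t, Real.exp (μ * s) * r s)
      (Real.exp (μ * t) * r t) t :=
    ((by fun_prop : Continuous fun s => Real.exp (μ * s) * r s).integral_hasStrictDerivAt
      0 t).hasDerivAt
  have h2 := (hasDerivAt_const_mul (-μ) (x := t)).exp
  have h3 := h2.mul (h1.const_add θ)
  refine h3.congr_deriv ?_
  have : Real.exp (-μ * t) * Real.exp (μ * t) = 1 := by rw [← Real.exp_add]; simp
  unfold duhamel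
  linear_combination r t * this

@[fun_prop] lemma continuous_duhamel (μ θ : ℝ) {r : ℝ → ℝ} (hr : Continuous r) :
    Continuous (duhamel μ θ r) :=
  continuous_iff_continuousAt.2 fun t => (hasDerivAt_duhamel μ θ hr t).continuousAt

lemma duhamel_sub (μ θ θ' : ℝ) {r r' : ℝ → ℝ} (hr : Continuous r) (hr' : Continuous r') (t : ℝ) :
    duhamel μ θ r t - duhamel μ θ' r' t = duhamel μ (θ - θ') (fun s => r s - r' s) t := by
  unfold duhamel
  simp_rw [mul_sub (Real.exp (μ * _))]
  rw [intervalIntegral.integral_sub (by apply Continuous.intervalIntegrable; fun_prop)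
          (by apply Continuous.intervalIntegrable; fun_prop)]
  ring

lemma abs_duhamel_le {μ θ κ M : ℝ} {r : ℝ → ℝ} (hr : Continuous r) (hκ : 0 < μ + κ)
    {t : ℝ} (ht : 0 ≤ t) (hM : ∀ s, 0 ≤ s → |r s| ≤ M * Real.exp (κ * s)) :
    |duhamel μ θ r t| ≤ Real.exp (κ * t) * (|θ| + M / (μ + κ)) := by
  have hM0 : 0 ≤ M := by
    have := (abs_nonneg _).trans (hM 0 le_rfl); simpa using this
  have hI : |∫ s in (0 : ℝ)..t, Real.exp (μ * s) * r s|
      ≤ M * ((Real.exp ((μ + κ) * t) - 1) / (μ + κ)) := by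
    have h1 : ∫ s in (0 : ℝ)..t, M * Real.exp ((μ + κ) * s)
        = M * ((Real.exp ((μ + κ) * t) - 1) / (μ + κ)) := by
      rw [intervalIntegral.integral_const_mul,
        intervalIntegral.integral_comp_mul_left _ hκ.ne', integral_exp]
      simp [div_eq_inv_mul]
    rw [← h1]
    refine (intervalIntegral.abs_integral_le_integral_abs ht).trans ?_
    refine intervalIntegral.integral_mono_on ht
      (by apply Continuous.intervalIntegrable; fun_prop)
      (by apply Continuous.intervalIntegrable; fun_prop) fun s hs => ?_
    rw [abs_mul, Real.abs_exp, add_mul, Real.exp_add]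
    have := mul_le_mul_of_nonneg_left (hM s hs.1) (Real.exp_pos (μ * s)).le
    linarith
  have e1 : Real.exp (-μ * t) ≤ Real.exp (κ * t) :=
    Real.exp_le_exp.2 (by nlinarith)
  have e2 : Real.exp (-μ * t) * Real.exp ((μ + κ) * t) = Real.exp (κ * t) := by
    rw [← Real.exp_add]; ring_nf
  have e3 := Real.exp_pos (-μ * t)
  unfold duhamel
  rw [abs_mul, Real.abs_exp]
  calc Real.exp (-μ * t) * |θ + ∫ s in (0 : ℝ)..t, Real.exp (μ * s) * r s|
      ≤ Real.exp (-μ * t) * (|θ| + M * ((Real.exp ((μ + κ) * t) - 1) / (μ + κ))) := by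
        gcongr
        exact (abs_add_le _ _).trans (by gcongr)
    _ = Real.exp (-μ * t) * |θ| + (Real.exp (-μ * t) * Real.exp ((μ + κ) * t)) * (M / (μ + κ))
          - Real.exp (-μ * t) * (M / (μ + κ)) := by ring
    _ ≤ Real.exp (κ * t) * |θ| + Real.exp (κ * t) * (M / (μ + κ)) := by
        rw [e2]
        have : 0 ≤ Real.exp (-μ * t) * (M / (μ + κ)) := by positivity
        have := mul_le_mul_of_nonneg_right e1 (abs_nonneg θ)
        linarith
    _ = _ := by ring

/-- Large exponential weights make the kernel of the trace equation small. -/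
lemma exists_weight {μ : ℕ → ℝ} {κ₀ : ℝ} (hμ : ∀ n, 0 < μ n + κ₀)
    (hs : Summable fun n => 1 / (μ n + κ₀)) (C : ℝ) :
    ∃ κ ≥ κ₀, C * ∑' n, 1 / (μ n + κ) ≤ 1 / 2 := by
  have hlim : Filter.Tendsto (fun κ : ℝ => ∑' n, 1 / (μ n + κ)) Filter.atTop
      (nhds (∑' _ : ℕ, (0 : ℝ))) := by
    refine tendsto_tsum_of_dominated_convergence hs (fun n => ?_) ?_
    · simp_rw [one_div]
      exact (Filter.tendsto_atTop_add_const_left _ _ Filter.tendsto_id).inv_tendsto_atTop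
    · filter_upwards [Filter.eventually_ge_atTop κ₀] with κ hκ n
      have := hμ n
      rw [Real.norm_of_nonneg (by apply one_div_nonneg.2; linarith)]
      exact one_div_le_one_div_of_le (hμ n) (by linarith)
  rw [tsum_zero] at hlim
  have h2 := hlim.const_mul C
  rw [mul_zero] at h2
  obtain ⟨κ, h3, h4⟩ := ((h2.eventually (gt_mem_nhds (by norm_num : (0 : ℝ) < 1 / 2))).and
    (Filter.eventually_ge_atTop κ₀)).exists
  exact ⟨κ, h4, h3.le⟩

/-- Solvability of the trace equation `x(t) = ∑ σₙ yₙ(t)`, where `yₙ' = -μₙ yₙ + Rₙ(x)` and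
`yₙ(0) = θₙ`, for a causal Lipschitz source `R`. In the norm `sup e^{-κ t} |x(t)|` with large `κ`
the right-hand side is a contraction, because `∑ 1 / (μₙ + κ)` is small. -/
lemma exists_trace {μ θ σ : ℕ → ℝ} {κ₀ C M : ℝ} (hκ₀ : 0 ≤ κ₀) (hμ : ∀ n, 0 < μ n + κ₀)
    (hs : Summable fun n => 1 / (μ n + κ₀)) (hθ : Summable fun n => |θ n|)
    (hσ : ∀ n, |σ n| ≤ 1) (R : (ℝ → ℝ) → ℕ → ℝ → ℝ)
    (hRc : ∀ x, Continuous x → ∀ n, Continuous (R x n))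
    (hR0 : ∀ n t, 0 ≤ t → |R (fun _ => 0) n t| ≤ M)
    (hRl : ∀ x x' : ℝ → ℝ, Continuous x → Continuous x' → ∀ κ ≥ 0, ∀ δ ≥ 0,
      (∀ t ≥ 0, |x t - x' t| ≤ δ * Real.exp (κ * t)) →
      ∀ n, ∀ t ≥ 0, |R x n t - R x' n t| ≤ C * δ * Real.exp (κ * t)) :
    ∃ (x : ℝ → ℝ) (κ : ℝ) (β : ℕ → ℝ), Continuous x ∧ Summable β ∧
      (∀ n, ∀ t ≥ 0, |duhamel (μ n) (θ n) (R x n) t| ≤ Real.exp (κ * t) * β n) ∧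
      ∀ t ≥ 0, x t = ∑' n, σ n * duhamel (μ n) (θ n) (R x n) t := by
  obtain ⟨κ, hκ, hκC⟩ := exists_weight hμ hs C
  have hκ0 : 0 ≤ κ := hκ₀.trans hκ
  have hμκ : ∀ n, 0 < μ n + κ := fun n => by have := hμ n; linarith
  have hsκ : Summable fun n => 1 / (μ n + κ) := by
    refine hs.of_nonneg_of_le (fun n => (one_div_pos.2 (hμκ n)).le) fun n => ?_
    exact one_div_le_one_div_of_le (hμ n) (by linarith)
  have hM : 0 ≤ M := (abs_nonneg _).trans (hR0 0 0 le_rfl)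
  -- `w X` removes the weight from a bounded function and freezes it on the negative half-line
  let w : BoundedContinuousFunction ℝ ℝ → ℝ → ℝ := fun X τ => Real.exp (κ * max τ 0) * X (max τ 0)
  have hwc : ∀ X, Continuous (w X) := fun X => by
    have := X.continuous
    fun_prop
  have hwd : ∀ X Y, ∀ t ≥ 0, |w X t - w Y t| ≤ dist X Y * Real.exp (κ * t) := by
    intro X Y t ht
    have := BoundedContinuousFunction.dist_coe_le_dist (f := X) (g := Y) t
    rw [Real.dist_eq] at this
    simp only [w, max_eq_left ht, ← mul_sub, abs_mul, Real.abs_exp]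
    rw [mul_comm]
    gcongr
  have hRb : ∀ X n, ∀ t ≥ 0, |R (w X) n t| ≤ (M + C * ‖X‖) * Real.exp (κ * t) := by
    intro X n t ht
    have h1 := hRl (w X) (fun _ => 0) (hwc X) continuous_const κ hκ0 ‖X‖ (norm_nonneg _)
      (fun t ht => by
        have := hwd X 0 t ht
        rwa [dist_zero_right, show w 0 t = 0 by simp [w]] at this) n t ht
    have h2 := hR0 n t ht
    have h3 : 1 ≤ Real.exp (κ * t) := Real.one_le_exp (by positivity)
    have h4 : |R (w X) n t| ≤ |R (w X) n t - R (fun _ => 0) n t| + |R (fun _ => 0) n t| := by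
      simpa using abs_add_le (R (w X) n t - R (fun _ => 0) n t) (R (fun _ => 0) n t)
    nlinarith
  let y : BoundedContinuousFunction ℝ ℝ → ℕ → ℝ → ℝ :=
    fun X n t => duhamel (μ n) (θ n) (R (w X) n) t
  let β : BoundedContinuousFunction ℝ ℝ → ℕ → ℝ := fun X n => |θ n| + (M + C * ‖X‖) / (μ n + κ)
  have hβ : ∀ X, Summable (β X) := fun X => by
    refine hθ.add ?_
    simpa [div_eq_mul_inv] using hsκ.mul_left (M + C * ‖X‖)
  have hy : ∀ X n, ∀ t ≥ 0, |y X n t| ≤ Real.exp (κ * t) * β X n := fun X n t ht =>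
    abs_duhamel_le (hRc _ (hwc X) n) (hμκ n) ht (hRb X n)
  have hterm : ∀ X n t, ‖Real.exp (-(κ * max t 0)) * (σ n * y X n (max t 0))‖ ≤ β X n := by
    intro X n t
    have h1 := hy X n (max t 0) (le_max_right _ _)
    rw [Real.norm_eq_abs, abs_mul, Real.abs_exp, abs_mul, Real.exp_neg,
      inv_mul_le_iff₀ (Real.exp_pos _)]
    calc |σ n| * |y X n (max t 0)| ≤ 1 * |y X n (max t 0)| := by gcongr; exact hσ n
      _ ≤ _ := by rwa [one_mul]
  have hcont : ∀ X, Continuous fun t =>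
      ∑' n, Real.exp (-(κ * max t 0)) * (σ n * y X n (max t 0)) := by
    intro X
    refine continuous_tsum (fun n => ?_) (hβ X) (fun n t => hterm X n t)
    have := continuous_duhamel (μ n) (θ n) (hRc _ (hwc X) n)
    fun_prop
  let Φ : BoundedContinuousFunction ℝ ℝ → BoundedContinuousFunction ℝ ℝ := fun X =>
    BoundedContinuousFunction.ofNormedAddCommGroup _ (hcont X) (∑' n, β X n) fun t =>
      tsum_of_norm_bounded (hβ X).hasSum fun n => hterm X n t
  have hΦ : ∀ X t, Φ X t = ∑' n, Real.exp (-(κ * max t 0)) * (σ n * y X n (max t 0)) :=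
    fun _ _ => rfl
  have hlip : ∀ X Y, dist (Φ X) (Φ Y) ≤ 1 / 2 * dist X Y := by
    intro X Y
    refine (BoundedContinuousFunction.dist_le (by positivity)).2 fun t => ?_
    have hsX : Summable fun n => Real.exp (-(κ * max t 0)) * (σ n * y X n (max t 0)) :=
      (hβ X).of_norm_bounded fun n => hterm X n t
    have hsY : Summable fun n => Real.exp (-(κ * max t 0)) * (σ n * y Y n (max t 0)) :=
      (hβ Y).of_norm_bounded fun n => hterm Y n t
    rw [hΦ, hΦ, dist_eq_norm, ← hsX.tsum_sub hsY]
    have hsum := (hsκ.mul_left (C * dist X Y))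
    refine (tsum_of_norm_bounded hsum.hasSum fun n => ?_).trans ?_
    · have hd : |y X n (max t 0) - y Y n (max t 0)|
          ≤ Real.exp (κ * max t 0) * (C * dist X Y / (μ n + κ)) := by
        have h1 := hRl (w X) (w Y) (hwc X) (hwc Y) κ hκ0 (dist X Y) dist_nonneg (hwd X Y) n
        have h2 := abs_duhamel_le (θ := θ n - θ n)
          (r := fun s => R (w X) n s - R (w Y) n s)
          ((hRc _ (hwc X) n).sub (hRc _ (hwc Y) n)) (hμκ n)
          (le_max_right t 0) h1
        rw [← duhamel_sub _ _ _ (hRc _ (hwc X) n) (hRc _ (hwc Y) n), sub_self, abs_zero,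
          zero_add] at h2
        exact h2
      rw [← mul_sub, ← mul_sub, Real.norm_eq_abs, abs_mul, Real.abs_exp, abs_mul, Real.exp_neg,
        inv_mul_le_iff₀ (Real.exp_pos _), mul_one_div]
      calc |σ n| * |y X n (max t 0) - y Y n (max t 0)|
          ≤ 1 * |y X n (max t 0) - y Y n (max t 0)| := by gcongr; exact hσ n
        _ ≤ _ := by rwa [one_mul]
    · rw [tsum_mul_left]
      nlinarith [dist_nonneg (x := X) (y := Y)]
  have hcontr : ContractingWith (1 / 2) Φ :=
    ⟨by norm_num [← NNReal.coe_lt_coe], LipschitzWith.of_dist_le_mul fun X Y => by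
      simpa using hlip X Y⟩
  let X := ContractingWith.fixedPoint Φ hcontr
  have hX : Φ X = X := hcontr.fixedPoint_isFixedPt
  refine ⟨w X, κ, β X, hwc X, hβ X, hy X, fun t ht => ?_⟩
  have h1 := hΦ X t
  rw [hX, max_eq_left ht, tsum_mul_left] at h1
  simp only [w, max_eq_left ht]
  rw [h1, ← mul_assoc, ← Real.exp_add, add_neg_cancel, Real.exp_zero, one_mul]

/-! ### The time derivative of the parabolic component -/

/-- The time derivative `k x(τ₊) + h₀(τ)` of the signal entering the transport equation, where `x`
is the trace of `∂u₁/∂t` at `z = 1`. The function `h₀` vanishes for `τ ≥ 0`, and for `τ < 0` it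
corrects the frozen value `k x(0)` to the one prescribed by the initial profile. -/
noncomputable def history (k : ℝ) (h₀ x : ℝ → ℝ) (τ : ℝ) : ℝ := k * x (max τ 0) + h₀ τ

/-- The source `∫₀¹ B(z,s) H(t - s/c) ds` produced in the parabolic equation by the transported
signal `H`. -/
noncomputable def source (c : ℝ) (B : ℝ → ℝ → ℝ) (H : ℝ → ℝ) (t z : ℝ) : ℝ :=
  ∫ s in (0 : ℝ)..1, B z s * H (t - s / c)

/-- The `n`-th sine coefficient of the forcing in the equation of `∂u₁/∂t`: the distributed source
together with the boundary flux `q x(t)`. The factor `2` normalises `sinMode n`, and the sign is the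
value of `sinMode n` at `1`, which appears when the diffusion term is integrated by parts. -/
noncomputable def forcing (p c q k : ℝ) (B : ℝ → ℝ → ℝ) (h₀ x : ℝ → ℝ) (n : ℕ) (t : ℝ) : ℝ :=
  2 * (∫ z in (0 : ℝ)..1, source c B (history k h₀ x) t z * sinMode n z)
    + 2 * p * q * x t * (-1) ^ n

lemma continuous_history {k : ℝ} {h₀ x : ℝ → ℝ} (hh : Continuous h₀) (hx : Continuous x) :
    Continuous (history k h₀ x) := by
  unfold history; fun_prop

lemma continuous_source (c : ℝ) {B : ℝ → ℝ → ℝ} {H : ℝ → ℝ} (hB : Continuous ↿B)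
    (hH : Continuous H) : Continuous ↿(source c B H) := by
  refine intervalIntegral.continuous_parametric_intervalIntegral_of_continuous' (μ := volume)
    (f := fun (x : ℝ × ℝ) s => B x.2 s * H (x.1 - s / c)) ?_ 0 1
  have : Continuous fun y : (ℝ × ℝ) × ℝ => B y.1.2 y.2 :=
    hB.comp (by fun_prop : Continuous fun y : (ℝ × ℝ) × ℝ => (y.1.2, y.2))
  exact this.mul (by fun_prop)

/-- The nearest point of `[0,1]`, used to extend functions from `[0,1]` to the line. -/
noncomputable def clamp (z : ℝ) : ℝ := max 0 (min 1 z)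

lemma clamp_mem (z : ℝ) : clamp z ∈ Icc (0 : ℝ) 1 :=
  ⟨le_max_left _ _, max_le zero_le_one (min_le_left _ _)⟩

lemma clamp_of_mem {z : ℝ} (hz : z ∈ Icc (0 : ℝ) 1) : clamp z = z := by
  rw [clamp, min_eq_right hz.2, max_eq_right hz.1]

lemma clamp_of_nonpos {z : ℝ} (hz : z ≤ 0) : clamp z = 0 :=
  max_eq_left ((min_le_right _ _).trans hz)

@[fun_prop] lemma continuous_clamp : Continuous clamp := by unfold clamp; fun_prop

lemma continuous_comp_clamp {f : ℝ → ℝ} (hf : ContinuousOn f (Icc 0 1)) :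
    Continuous (f ∘ clamp) :=
  hf.comp_continuous continuous_clamp clamp_mem

lemma continuous_integral_mul_sinMode {g : ℝ → ℝ → ℝ} (hg : Continuous ↿g) (n : ℕ) :
    Continuous fun t => ∫ z in (0 : ℝ)..1, g t z * sinMode n z := by
  refine intervalIntegral.continuous_parametric_intervalIntegral_of_continuous' (μ := volume)
    (f := fun t z => g t z * sinMode n z) ?_ 0 1
  exact hg.mul (by fun_prop : Continuous fun y : ℝ × ℝ => sinMode n y.2)

lemma continuous_forcing {p c q k : ℝ} {B : ℝ → ℝ → ℝ} {h₀ x : ℝ → ℝ} (hB : Continuous ↿B)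
    (hh : Continuous h₀) (hx : Continuous x) (n : ℕ) :
    Continuous (forcing p c q k B h₀ x n) := by
  have := continuous_integral_mul_sinMode
    (continuous_source c hB (continuous_history (k := k) hh hx)) n
  unfold forcing
  fun_prop

lemma abs_integral_mul_sinMode_le {g : ℝ → ℝ} {M : ℝ} (hM : ∀ z ∈ Icc (0 : ℝ) 1, |g z| ≤ M)
    (n : ℕ) : |∫ z in (0 : ℝ)..1, g z * sinMode n z| ≤ M := by
  have := intervalIntegral.norm_integral_le_of_norm_le_const (a := (0 : ℝ)) (b := 1)
    (f := fun z => g z * sinMode n z) (C := M) (fun z hz => by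
      rw [uIoc_of_le zero_le_one] at hz
      have h1 := hM z (Ioc_subset_Icc_self hz)
      rw [Real.norm_eq_abs, abs_mul]
      exact (mul_le_of_le_one_right (abs_nonneg _) (abs_sinMode_le n z)).trans h1)
  simpa using this

lemma abs_source_le {c : ℝ} {B : ℝ → ℝ → ℝ} {H : ℝ → ℝ} {b M t : ℝ} (hc : 0 < c)
    (hb : ∀ z ∈ Icc (0 : ℝ) 1, ∀ s ∈ Icc (0 : ℝ) 1, |B z s| ≤ b)
    (hM : ∀ τ ≤ t, |H τ| ≤ M) :
    ∀ z ∈ Icc (0 : ℝ) 1, |source c B H t z| ≤ b * M := by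
  intro z hz
  have := intervalIntegral.norm_integral_le_of_norm_le_const (a := (0 : ℝ)) (b := 1)
    (f := fun s => B z s * H (t - s / c)) (C := b * M) (fun s hs => by
      rw [uIoc_of_le zero_le_one] at hs
      rw [Real.norm_eq_abs, abs_mul]
      have h0 : 0 ≤ s / c := div_nonneg hs.1.le hc.le
      have h1 := hb z hz s (Ioc_subset_Icc_self hs)
      have h2 := hM (t - s / c) (by linarith)
      have := (abs_nonneg _).trans h1
      gcongr)
  simpa [source] using this

/-- The sine coefficients of a uniformly convergent sine series. -/
lemma integral_tsum_mul_sinMode {y β : ℕ → ℝ} (hβ : Summable β) (hy : ∀ n, |y n| ≤ β n) (m : ℕ) :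
    ∫ z in (0 : ℝ)..1, (∑' n, y n * sinMode n z) * sinMode m z = y m / 2 := by
  have hb : ∀ n z, ‖y n * sinMode n z‖ ≤ β n := fun n z => by
    rw [Real.norm_eq_abs, abs_mul]
    exact (mul_le_of_le_one_right (abs_nonneg _) (abs_sinMode_le n z)).trans (hy n)
  have hs : ∀ z, HasSum (fun n => y n * sinMode n z * sinMode m z)
      ((∑' n, y n * sinMode n z) * sinMode m z) := fun z =>
    (hβ.of_norm_bounded (hb · z)).hasSum.mul_right _
  have h1 := intervalIntegral.hasSum_integral_of_dominated_convergence (μ := volume)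
    (a := 0) (b := 1) (F := fun n z => y n * sinMode n z * sinMode m z)
    (f := fun z => (∑' n, y n * sinMode n z) * sinMode m z) (fun n _ => β n)
    (fun n => Continuous.aestronglyMeasurable (by fun_prop))
    (fun n => Filter.Eventually.of_forall fun z _ => by
      rw [norm_mul]
      exact (mul_le_of_le_one_right (norm_nonneg _) (abs_sinMode_le m z)).trans (hb n z))
    (Filter.Eventually.of_forall fun z _ => hβ)
    (by simp)
    (Filter.Eventually.of_forall fun z _ => hs z)
  have h2 : ∀ n, ∫ z in (0 : ℝ)..1, y n * sinMode n z * sinMode m z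
      = if n = m then y m / 2 else 0 := by
    intro n
    simp_rw [mul_assoc]
    rw [intervalIntegral.integral_const_mul, integral_sinMode_mul_sinMode]
    split_ifs with h
    · subst h; ring
    · ring
  simp_rw [h2] at h1
  exact h1.unique (hasSum_ite_eq m _)

lemma summable_sineCoeff {θ g : ℝ → ℝ} (hθ : ContDiffOn ℝ 1 θ (Icc 0 1)) (hg : MemL2 g)
    (h : HasWeakDeriv 2 θ g) (h0 : θ 0 = 0) :
    Summable fun n => |2 * ∫ z in (0 : ℝ)..1, θ z * sinMode n z| := by
  set C := |derivWithin θ (Icc 0 1) 1| + ∫ z in (0 : ℝ)..1, |g z|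
  refine (summable_inv_freq_sq.mul_left (2 * C)).of_nonneg_of_le (fun n => abs_nonneg _)
    fun n => ?_
  have h1 := freq_sq_mul_integral_mul_sinMode hθ hg h h0 n
  have hω := freq_pos n
  have h2 : |∫ z in (0 : ℝ)..1, g z * sinMode n z| ≤ ∫ z in (0 : ℝ)..1, |g z| := by
    refine (intervalIntegral.abs_integral_le_integral_abs zero_le_one).trans ?_
    refine intervalIntegral.integral_mono_on zero_le_one
      (hg.intervalIntegrable.mul_continuousOn (by fun_prop)).abs hg.intervalIntegrable.abs
      fun z _ => ?_
    rw [abs_mul]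
    exact mul_le_of_le_one_right (abs_nonneg _) (abs_sinMode_le n z)
  have h3 : freq n ^ 2 * |∫ z in (0 : ℝ)..1, θ z * sinMode n z| ≤ C := by
    rw [← abs_of_pos (pow_pos hω 2), ← abs_mul, h1]
    refine (abs_sub _ _).trans (add_le_add ?_ h2)
    simp [abs_mul]
  rw [abs_mul, abs_two, mul_one_div, le_div_iff₀ (by positivity)]
  linarith

/-- Existence of the time derivative `v` of the parabolic component: `v` solves, in terms of its
sine coefficients, the parabolic problem with initial value `θ` and with the history signal driven
by its own trace `v(t,1)`. -/
lemma exists_timeDeriv {p c q a k : ℝ} (hp : 0 < p) (hc : 0 < c) {B : ℝ → ℝ → ℝ}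
    (hB : Continuous ↿B) {h₀ : ℝ → ℝ} (hh : Continuous h₀) {m₀ : ℝ} (hm₀ : ∀ τ, |h₀ τ| ≤ m₀)
    {θ g : ℝ → ℝ} (hθ : ContDiffOn ℝ 1 θ (Icc 0 1)) (hg : MemL2 g)
    (hθg : HasWeakDeriv 2 θ g) (hθ0 : θ 0 = 0) :
    ∃ v : ℝ → ℝ → ℝ, Continuous ↿v ∧ (∀ z ∈ Icc (0 : ℝ) 1, v 0 z = θ z) ∧
      ∀ n, ∀ t ≥ 0, (∫ z in (0 : ℝ)..1, v t z * sinMode n z) - ∫ z in (0 : ℝ)..1, θ z * sinMode n z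
        = ∫ τ in (0 : ℝ)..t, (-(p * freq n ^ 2 - a) * (∫ z in (0 : ℝ)..1, v τ z * sinMode n z)
          + (∫ z in (0 : ℝ)..1, source c B (history k h₀ (fun t => v t 1)) τ z * sinMode n z)
          + p * q * v τ 1 * (-1) ^ n) := by
  obtain ⟨b, hb⟩ : ∃ b, ∀ z ∈ Icc (0 : ℝ) 1, ∀ s ∈ Icc (0 : ℝ) 1, |B z s| ≤ b := by
    obtain ⟨b, hb⟩ := (isCompact_Icc.prod isCompact_Icc).exists_bound_of_continuousOn
      (hB.continuousOn (s := Icc (0 : ℝ) 1 ×ˢ Icc (0 : ℝ) 1))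
    exact ⟨b, fun z hz s hs => hb (z, s) ⟨hz, hs⟩⟩
  set μ : ℕ → ℝ := fun n => p * freq n ^ 2 - a with hμ
  set θ' : ℕ → ℝ := fun n => 2 * ∫ z in (0 : ℝ)..1, θ z * sinMode n z with hθ'
  have hμpos : ∀ n, p * freq n ^ 2 ≤ μ n + |a| := fun n => by
    have := le_abs_self a
    simp only [hμ]; linarith
  have hω : ∀ n, 0 < p * freq n ^ 2 := fun n => mul_pos hp (pow_pos (freq_pos n) 2)
  have hsμ : Summable fun n => 1 / (μ n + |a|) := by
    refine (summable_inv_freq_sq.mul_left p⁻¹).of_nonneg_of_le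
      (fun n => one_div_nonneg.2 ((hω n).le.trans (hμpos n))) fun n => ?_
    have := one_div_le_one_div_of_le (hω n) (hμpos n)
    rwa [one_div (p * _), mul_inv, ← one_div (freq n ^ 2)] at this
  obtain ⟨x, κ, β, hx, hβ, hyβ, hxe⟩ := exists_trace (μ := μ) (θ := θ') (σ := fun n => (-1) ^ n)
    (C := 2 * b * |k| + 2 * p * |q|) (M := 2 * (b * m₀)) (abs_nonneg a)
    (fun n => (hω n).trans_le (hμpos n)) hsμ (summable_sineCoeff hθ hg hθg hθ0)
    (fun n => by simp) (forcing p c q k B h₀)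
    (fun x hx n => continuous_forcing hB hh hx n)
    (fun n t _ => by
      have h1 : ∀ τ ≤ t, |history k h₀ (fun _ => 0) τ| ≤ m₀ := fun τ _ => by
        simpa [history] using hm₀ τ
      have h2 := abs_integral_mul_sinMode_le (abs_source_le hc hb h1) n
      simp only [forcing, mul_zero, zero_mul, add_zero, abs_mul, abs_two]
      linarith)
    (fun x x' hx hx' κ hκ δ hδ hxx n t ht => by
      have h1 : ∀ τ ≤ t, |history k h₀ x τ - history k h₀ x' τ|
          ≤ |k| * (δ * Real.exp (κ * t)) := fun τ hτ => by
        have h2 := hxx (max τ 0) (le_max_right _ _)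
        have h3 : Real.exp (κ * max τ 0) ≤ Real.exp (κ * t) :=
          Real.exp_le_exp.2 (mul_le_mul_of_nonneg_left (max_le hτ ht) hκ)
        rw [history, history, add_sub_add_right_eq_sub, ← mul_sub, abs_mul]
        gcongr
        exact h2.trans (by gcongr)
      have hH := continuous_history (k := k) hh hx
      have hH' := continuous_history (k := k) hh hx'
      have hS : Continuous (source c B (history k h₀ x) t) :=
        (continuous_source c hB hH).comp (by fun_prop : Continuous fun z : ℝ => (t, z))
      have hS' : Continuous (source c B (history k h₀ x') t) :=
        (continuous_source c hB hH').comp (by fun_prop : Continuous fun z : ℝ => (t, z))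
      have hsrc : ∀ z, source c B (history k h₀ x) t z - source c B (history k h₀ x') t z
          = source c B (fun τ => history k h₀ x τ - history k h₀ x' τ) t z := fun z => by
        have hBz : Continuous (B z) := hB.comp (by fun_prop : Continuous fun s : ℝ => (z, s))
        unfold source
        rw [← intervalIntegral.integral_sub (by apply Continuous.intervalIntegrable; fun_prop)
          (by apply Continuous.intervalIntegrable; fun_prop)]
        simp_rw [mul_sub]
      have h4 := abs_integral_mul_sinMode_le (abs_source_le hc hb h1) n
      simp_rw [← hsrc, sub_mul] at h4
      rw [intervalIntegral.integral_sub (by apply Continuous.intervalIntegrable; fun_prop)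
          (by apply Continuous.intervalIntegrable; fun_prop)] at h4
      have h5 := hxx t ht
      set I := ∫ z in (0 : ℝ)..1, source c B (history k h₀ x) t z * sinMode n z
      set I' := ∫ z in (0 : ℝ)..1, source c B (history k h₀ x') t z * sinMode n z
      have h6 : forcing p c q k B h₀ x n t - forcing p c q k B h₀ x' n t
          = 2 * (I - I') + 2 * p * q * (-1) ^ n * (x t - x' t) := by
        simp only [forcing, I, I']; ring
      rw [h6]
      refine (abs_add_le _ _).trans ?_
      simp only [abs_mul, abs_two, abs_pow, abs_neg, abs_one, one_pow, mul_one, abs_of_pos hp]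
      have : 2 * p * |q| * |x t - x' t| ≤ 2 * p * |q| * (δ * Real.exp (κ * t)) := by gcongr
      linarith)
  have hf := fun n => continuous_forcing (p := p) (c := c) (q := q) (k := k) hB hh hx n
  let y : ℕ → ℝ → ℝ := fun n => duhamel (μ n) (θ' n) (forcing p c q k B h₀ x n)
  have hyc : ∀ n, Continuous (y n) := fun n => continuous_duhamel _ _ (hf n)
  let v : ℝ → ℝ → ℝ := fun t z => ∑' n, y n (max t 0) * sinMode n z
  have hvc : Continuous ↿v := by
    have e : ↿v = fun w : ℝ × ℝ => Real.exp (κ * max w.1 0) *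
        ∑' n, Real.exp (-(κ * max w.1 0)) * (y n (max w.1 0) * sinMode n w.2) := by
      funext w
      rw [tsum_mul_left, ← mul_assoc, ← Real.exp_add, add_neg_cancel, Real.exp_zero, one_mul]
      rfl
    rw [e]
    refine Continuous.mul (by fun_prop) (continuous_tsum (fun n => ?_) hβ fun n w => ?_)
    · have := hyc n
      fun_prop
    · rw [Real.norm_eq_abs, abs_mul, Real.abs_exp, abs_mul, Real.exp_neg,
        inv_mul_le_iff₀ (Real.exp_pos _)]
      exact (mul_le_of_le_one_right (abs_nonneg _) (abs_sinMode_le n w.2)).trans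
        (hyβ n (max w.1 0) (le_max_right _ _))
  have hvx : ∀ t ≥ 0, v t 1 = x t := fun t ht => by
    rw [hxe t ht]
    simp only [v, y, max_eq_left ht, sinMode_one, mul_comm]
  have hcoef : ∀ n, ∀ t ≥ 0, ∫ z in (0 : ℝ)..1, v t z * sinMode n z = y n t / 2 :=
    fun n t ht => by
      have := integral_tsum_mul_sinMode (y := fun n => y n (max t 0)) (hβ.mul_left _)
        (fun n => hyβ n (max t 0) (le_max_right _ _)) n
      simp only [v]
      rwa [max_eq_left ht] at this ⊢
  have hhist : history k h₀ (fun t => v t 1) = history k h₀ x := by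
    funext τ
    rw [history, history, hvx _ (le_max_right _ _)]
  refine ⟨v, hvc, fun z hz => ?_, fun n t ht => ?_⟩
  · have hext := continuous_comp_clamp hθ.continuousOn
    have hv0 : Continuous (v 0) := hvc.comp (by fun_prop : Continuous fun z : ℝ => ((0 : ℝ), z))
    have hθext : ∀ z ∈ Icc (0 : ℝ) 1, (θ ∘ clamp) z = θ z :=
      fun z hz => by rw [Function.comp_apply, clamp_of_mem hz]
    have := eq_zero_of_integral_mul_sinMode (hv0.sub hext) (fun n => by
      have hI : IntervalIntegrable (fun z => (θ ∘ clamp) z * sinMode n z) volume 0 1 :=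
        (hext.mul (continuous_sinMode n)).intervalIntegrable _ _
      simp only [Pi.sub_apply, sub_mul]
      rw [intervalIntegral.integral_sub (by apply Continuous.intervalIntegrable; fun_prop)
          hI, hcoef n 0 le_rfl,
          intervalIntegral.integral_congr (g := fun z => θ z * sinMode n z) (by
            rw [uIcc_of_le zero_le_one]
            intro z hz
            simp only [hθext z hz])]
      simp only [y, duhamel_zero, hθ']
      ring) z hz
    rw [Pi.sub_apply, hθext z hz, sub_eq_zero] at this
    exact this
  · rw [hcoef n t ht]
    have hFTC : ∫ τ in (0 : ℝ)..t, (-μ n * y n τ + forcing p c q k B h₀ x n τ)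
        = y n t - y n 0 :=
      intervalIntegral.integral_eq_sub_of_hasDerivAt
        (fun τ _ => hasDerivAt_duhamel (μ n) (θ' n) (hf n) τ)
        (by
          have := hf n
          have := hyc n
          apply Continuous.intervalIntegrable; fun_prop)
    have hy0 : y n 0 = 2 * ∫ z in (0 : ℝ)..1, θ z * sinMode n z := duhamel_zero _ _ _
    have e : ∀ τ ∈ uIcc 0 t,
        (-(p * freq n ^ 2 - a) * (∫ z in (0 : ℝ)..1, v τ z * sinMode n z)
          + (∫ z in (0 : ℝ)..1, source c B (history k h₀ (fun t => v t 1)) τ z * sinMode n z)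
          + p * q * v τ 1 * (-1) ^ n)
        = (1 / 2) * (-μ n * y n τ + forcing p c q k B h₀ x n τ) := by
      intro τ hτ
      rw [uIcc_of_le ht] at hτ
      rw [hcoef n τ hτ.1, hhist, hvx τ hτ.1, forcing]
      simp only [hμ]
      ring
    rw [intervalIntegral.integral_congr e, intervalIntegral.integral_const_mul, hFTC, hy0]
    ring

/-! ### Existence -/

/-- A function of two variables that is a primitive of continuous functions in each variable
separately is continuously differentiable up to the boundary. -/
lemma contDiffOn_of_eq_integral {u F G : ℝ → ℝ → ℝ} {I J : Set ℝ} (hI : UniqueDiffOn ℝ I)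
    (hJ : UniqueDiffOn ℝ J) (hF : Continuous ↿F) (hG : Continuous ↿G)
    (h1 : ∀ t ∈ I, ∀ t' ∈ I, ∀ z ∈ J, u t' z - u t z = ∫ τ in t..t', F τ z)
    (h2 : ∀ t ∈ I, ∀ z ∈ J, ∀ z' ∈ J, u t z' - u t z = ∫ s in z..z', G t s) :
    ContDiffOn ℝ 1 (fun x : ℝ × ℝ => u x.1 x.2) (I ×ˢ J) := by
  let L : ℝ × ℝ → (ℝ × ℝ →L[ℝ] ℝ) := fun x =>
    F x.1 x.2 • ContinuousLinearMap.fst ℝ ℝ ℝ + G x.1 x.2 • ContinuousLinearMap.snd ℝ ℝ ℝ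
  have hL : Continuous L := by
    have h1 : Continuous fun x : ℝ × ℝ => F x.1 x.2 := hF
    have h2 : Continuous fun x : ℝ × ℝ => G x.1 x.2 := hG
    fun_prop
  have hder : ∀ x ∈ I ×ˢ J, HasFDerivWithinAt (fun x : ℝ × ℝ => u x.1 x.2) (L x) (I ×ˢ J) x := by
    rintro ⟨t, z⟩ ⟨ht, hz⟩
    refine HasFDerivWithinAt.of_isLittleO (Asymptotics.isLittleO_iff.2 fun ε hε => ?_)
    obtain ⟨δ₁, hδ₁, hF'⟩ := Metric.continuousAt_iff.1 (hF.continuousAt (x := (t, z))) (ε / 2)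
      (half_pos hε)
    obtain ⟨δ₂, hδ₂, hG'⟩ := Metric.continuousAt_iff.1 (hG.continuousAt (x := (t, z))) (ε / 2)
      (half_pos hε)
    filter_upwards [self_mem_nhdsWithin,
      mem_nhdsWithin_of_mem_nhds (Metric.ball_mem_nhds (t, z) (lt_min hδ₁ hδ₂))]
    rintro ⟨t', z'⟩ ⟨ht', hz'⟩ hd
    rw [Metric.mem_ball, Prod.dist_eq, max_lt_iff, Real.dist_eq, Real.dist_eq] at hd
    have e1 : u t' z' - u t z' - F t z * (t' - t) = ∫ τ in t..t', (F τ z' - F t z) := by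
      have hc : Continuous fun τ => F τ z' :=
        hF.comp (by fun_prop : Continuous fun τ : ℝ => (τ, z'))
      rw [intervalIntegral.integral_sub (hc.intervalIntegrable _ _) (by simp),
        ← h1 t ht t' ht' z' hz', intervalIntegral.integral_const, smul_eq_mul, mul_comm]
    have e2 : u t z' - u t z - G t z * (z' - z) = ∫ s in z..z', (G t s - G t z) := by
      have hc : Continuous fun s => G t s :=
        hG.comp (by fun_prop : Continuous fun s : ℝ => (t, s))
      rw [intervalIntegral.integral_sub (hc.intervalIntegrable _ _) (by simp),
        ← h2 t ht z hz z' hz', intervalIntegral.integral_const, smul_eq_mul, mul_comm]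
    have b1 : |u t' z' - u t z' - F t z * (t' - t)| ≤ ε / 2 * |t' - t| := by
      rw [e1, ← Real.norm_eq_abs]
      refine intervalIntegral.norm_integral_le_of_norm_le_const fun τ hτ => ?_
      have := abs_sub_left_of_mem_uIcc (uIoc_subset_uIcc hτ)
      refine (hF' (x := (τ, z')) ?_).le
      rw [Prod.dist_eq, max_lt_iff, Real.dist_eq, Real.dist_eq]
      exact ⟨this.trans_lt (hd.1.trans_le (min_le_left _ _)), hd.2.trans_le (min_le_left _ _)⟩
    have b2 : |u t z' - u t z - G t z * (z' - z)| ≤ ε / 2 * |z' - z| := by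
      rw [e2, ← Real.norm_eq_abs]
      refine intervalIntegral.norm_integral_le_of_norm_le_const fun s hs => ?_
      have := abs_sub_left_of_mem_uIcc (uIoc_subset_uIcc hs)
      refine (hG' (x := (t, s)) ?_).le
      rw [Prod.dist_eq, max_lt_iff, Real.dist_eq, Real.dist_eq]
      exact ⟨by simpa using hδ₂, this.trans_lt (hd.2.trans_le (min_le_right _ _))⟩
    have n1 : |t' - t| ≤ ‖((t', z') : ℝ × ℝ) - (t, z)‖ := le_max_left _ _
    have n2 : |z' - z| ≤ ‖((t', z') : ℝ × ℝ) - (t, z)‖ := le_max_right _ _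
    have e3 : u t' z' - u t z - L (t, z) ((t', z') - (t, z))
        = (u t' z' - u t z' - F t z * (t' - t)) + (u t z' - u t z - G t z * (z' - z)) := by
      simp [L]; ring
    rw [e3, Real.norm_eq_abs]
    refine (abs_add_le _ _).trans ?_
    nlinarith
  have hU : UniqueDiffOn ℝ (I ×ˢ J) := hI.prod hJ
  rw [show (1 : WithTop ℕ∞) = 0 + 1 from rfl, contDiffOn_succ_iff_fderivWithin hU]
  refine ⟨fun x hx => (hder x hx).differentiableWithinAt, by simp, ?_⟩
  rw [contDiffOn_zero]
  exact hL.continuousOn.congr fun x hx => (hder x hx).fderivWithin (hU x hx)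

lemma integral_integral_swap_of_continuous {F : ℝ → ℝ → ℝ} (hF : Continuous ↿F) (a b c d : ℝ) :
    ∫ x in a..b, ∫ y in c..d, F x y = ∫ y in c..d, ∫ x in a..b, F x y :=
  intervalIntegral_intervalIntegral_swap
    ((hF.continuousOn.integrableOn_compact (isCompact_uIcc.prod isCompact_uIcc)).mono_set
      (prod_mono uIoc_subset_uIcc uIoc_subset_uIcc))

lemma integral_integral_mul_sinMode {g : ℝ → ℝ → ℝ} (hg : Continuous ↿g) (n : ℕ) (t : ℝ) :
    ∫ z in (0 : ℝ)..1, (∫ τ in (0 : ℝ)..t, g τ z) * sinMode n z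
      = ∫ τ in (0 : ℝ)..t, ∫ z in (0 : ℝ)..1, g τ z * sinMode n z := by
  rw [integral_integral_swap_of_continuous
    (hg.mul (by fun_prop : Continuous fun y : ℝ × ℝ => sinMode n y.2) :
      Continuous ↿(fun τ z => g τ z * sinMode n z))]
  simp_rw [intervalIntegral.integral_mul_const]

/-- The time derivative of the source is the source of the differentiated signal. -/
lemma source_sub_source {c : ℝ} {B : ℝ → ℝ → ℝ} {H h : ℝ → ℝ} (hB : Continuous ↿B)
    (hh : Continuous h) (hH : ∀ τ, HasDerivAt H (h τ) τ) (t z : ℝ) :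
    source c B H t z - source c B H 0 z = ∫ τ in (0 : ℝ)..t, source c B h τ z := by
  have hHc : Continuous H := continuous_iff_continuousAt.2 fun τ => (hH τ).continuousAt
  have hBz : Continuous (B z) := hB.comp (by fun_prop : Continuous fun s : ℝ => (z, s))
  unfold source
  rw [integral_integral_swap_of_continuous (F := fun τ s => B z s * h (τ - s / c))
    (by change Continuous fun y : ℝ × ℝ => B z y.2 * h (y.1 - y.2 / c); fun_prop),
    ← intervalIntegral.integral_sub (by apply Continuous.intervalIntegrable; fun_prop)
          (by apply Continuous.intervalIntegrable; fun_prop)]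
  congr 1
  funext s
  have : ∫ τ in (0 : ℝ)..t, h (τ - s / c) = H (t - s / c) - H (0 - s / c) :=
    intervalIntegral.integral_eq_sub_of_hasDerivAt (f := fun τ => H (τ - s / c))
      (fun τ _ => by simpa using (hH (τ - s / c)).comp_sub_const τ (s / c))
      (by apply Continuous.intervalIntegrable; fun_prop)
  rw [intervalIntegral.integral_const_mul, this, mul_sub]

lemma contDiff_ellipticSol {h : ℝ → ℝ} (hh : Continuous h) (r : ℝ) :
    ContDiff ℝ 2 (ellipticSol h r) ∧ iteratedDeriv 2 (ellipticSol h r) = -h := by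
  have d1 : deriv (ellipticSol h r) = fun z => r + ∫ σ in z..1, h σ :=
    funext fun z => (hasDerivAt_ellipticSol hh r z).deriv
  have d2 : deriv (fun z => r + ∫ σ in z..1, h σ) = -h :=
    funext fun z => ((hasDerivAt_integral_to_one hh z).const_add r).deriv
  have c1 : ContDiff ℝ 1 (deriv (ellipticSol h r)) := by
    rw [d1, contDiff_one_iff_deriv, d2]
    exact ⟨fun z => ((hasDerivAt_integral_to_one hh z).const_add r).differentiableAt, hh.neg⟩
  refine ⟨?_, by rw [iteratedDeriv_succ, iteratedDeriv_one, d1, d2]⟩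
  rw [show (2 : WithTop ℕ∞) = 1 + 1 by norm_num, contDiff_succ_iff_deriv]
  exact ⟨fun z => (hasDerivAt_ellipticSol hh r z).differentiableAt, by simp, c1⟩

lemma continuous_add_integral {u₀ : ℝ → ℝ} {v : ℝ → ℝ → ℝ} (hu : Continuous u₀)
    (hv : Continuous ↿v) : Continuous ↿(fun t z => u₀ z + ∫ τ in (0 : ℝ)..t, v τ z) := by
  have h1 : Continuous fun x : ℝ × ℝ => ∫ τ in (0 : ℝ)..x.1, v τ x.2 :=
    intervalIntegral.continuous_parametric_intervalIntegral_of_continuous (μ := volume)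
      (f := fun (x : ℝ × ℝ) τ => v τ x.2)
      (hv.comp (by fun_prop : Continuous fun y : (ℝ × ℝ) × ℝ => (y.2, y.1.2))) continuous_fst
  exact (by fun_prop : Continuous fun x : ℝ × ℝ => u₀ x.2).add h1

/-- Integrating the equation of the time derivative `v` gives, at each time, an elliptic boundary
value problem for `u = u₀ + ∫ v`. This yields the second spatial derivative of `u` without
differentiating the sine series. -/
lemma add_integral_eq_ellipticSol {p c q a : ℝ} (hp : 0 < p) {B : ℝ → ℝ → ℝ} {H h : ℝ → ℝ}
    (hB : Continuous ↿B) (hh : Continuous h) (hH : ∀ τ, HasDerivAt H (h τ) τ)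
    {u₀ θ : ℝ → ℝ} {v : ℝ → ℝ → ℝ} (hu : Continuous u₀) (hv : Continuous ↿v)
    (hu₀ : ∀ n, p * freq n ^ 2 * (∫ z in (0 : ℝ)..1, u₀ z * sinMode n z)
      = p * q * u₀ 1 * (-1) ^ n - (∫ z in (0 : ℝ)..1, θ z * sinMode n z)
        + a * (∫ z in (0 : ℝ)..1, u₀ z * sinMode n z)
        + ∫ z in (0 : ℝ)..1, source c B H 0 z * sinMode n z)
    (hvθ : ∀ n, ∀ t ≥ 0,
      (∫ z in (0 : ℝ)..1, v t z * sinMode n z) - ∫ z in (0 : ℝ)..1, θ z * sinMode n z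
        = ∫ τ in (0 : ℝ)..t, (-(p * freq n ^ 2 - a) * (∫ z in (0 : ℝ)..1, v τ z * sinMode n z)
          + (∫ z in (0 : ℝ)..1, source c B h τ z * sinMode n z) + p * q * v τ 1 * (-1) ^ n)) :
    ∀ t ≥ 0, ∀ z ∈ Icc (0 : ℝ) 1, u₀ z + ∫ τ in (0 : ℝ)..t, v τ z
      = ellipticSol
        (fun z => (a * (u₀ z + ∫ τ in (0 : ℝ)..t, v τ z) + source c B H t z - v t z) / p)
        (q * (u₀ 1 + ∫ τ in (0 : ℝ)..t, v τ 1)) z := by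
  intro t ht
  have hHc : Continuous H := continuous_iff_continuousAt.2 fun τ => (hH τ).continuousAt
  have hslice : ∀ {g : ℝ → ℝ → ℝ}, Continuous ↿g → ∀ t, Continuous (g t) := fun hg t =>
    hg.comp (by fun_prop : Continuous fun z : ℝ => (t, z))
  have hw := continuous_add_integral hu hv
  have hwt := hslice hw t
  have hst := hslice (continuous_source c hB hHc) t
  have hs0 := hslice (continuous_source c hB hHc) 0
  have hvt := hslice hv t
  have hI : Continuous fun z => ∫ τ in (0 : ℝ)..t, v τ z := by
    refine (hwt.sub hu).congr fun z => ?_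
    simp
  have hhc : Continuous fun z =>
      (a * (u₀ z + ∫ τ in (0 : ℝ)..t, v τ z) + source c B H t z - v t z) / p :=
    (((continuous_const.mul hwt).add hst).sub hvt).div_const p
  refine eq_ellipticSol hwt hhc _ fun n => ?_
  have hsn := continuous_sinMode n
  have e1 : ∫ z in (0 : ℝ)..1, (u₀ z + ∫ τ in (0 : ℝ)..t, v τ z) * sinMode n z
      = (∫ z in (0 : ℝ)..1, u₀ z * sinMode n z)
        + ∫ τ in (0 : ℝ)..t, ∫ z in (0 : ℝ)..1, v τ z * sinMode n z := by
    rw [← integral_integral_mul_sinMode hv]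
    simp_rw [add_mul]
    exact intervalIntegral.integral_add (by apply Continuous.intervalIntegrable; fun_prop)
      (by apply Continuous.intervalIntegrable; fun_prop)
  have e2 : ∫ z in (0 : ℝ)..1,
        (a * (u₀ z + ∫ τ in (0 : ℝ)..t, v τ z) + source c B H t z - v t z) / p * sinMode n z
      = p⁻¹ * (a * (∫ z in (0 : ℝ)..1, (u₀ z + ∫ τ in (0 : ℝ)..t, v τ z) * sinMode n z)
        + (∫ z in (0 : ℝ)..1, source c B H t z * sinMode n z)
        - ∫ z in (0 : ℝ)..1, v t z * sinMode n z) := by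
    rw [← intervalIntegral.integral_const_mul, ← intervalIntegral.integral_add
      (by apply Continuous.intervalIntegrable; fun_prop)
      (by apply Continuous.intervalIntegrable; fun_prop), ← intervalIntegral.integral_sub
      (by apply Continuous.intervalIntegrable; fun_prop)
      (by apply Continuous.intervalIntegrable; fun_prop),
      ← intervalIntegral.integral_const_mul]
    congr 1
    funext z
    ring
  have e3 : (∫ z in (0 : ℝ)..1, source c B H t z * sinMode n z)
        - ∫ z in (0 : ℝ)..1, source c B H 0 z * sinMode n z
      = ∫ τ in (0 : ℝ)..t, ∫ z in (0 : ℝ)..1, source c B h τ z * sinMode n z := by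
    rw [← integral_integral_mul_sinMode (continuous_source c hB hh),
      ← intervalIntegral.integral_sub (by apply Continuous.intervalIntegrable; fun_prop)
        (by apply Continuous.intervalIntegrable; fun_prop)]
    congr 1
    funext z
    rw [← source_sub_source hB hh hH, sub_mul]
  have e4 := hvθ n t ht
  have cv := continuous_integral_mul_sinMode hv n
  have cs := continuous_integral_mul_sinMode (continuous_source c hB hh) n
  have c1 : Continuous fun τ => v τ 1 :=
    hv.comp (by fun_prop : Continuous fun τ : ℝ => (τ, (1 : ℝ)))
  rw [intervalIntegral.integral_add (by apply Continuous.intervalIntegrable; fun_prop)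
      (by apply Continuous.intervalIntegrable; fun_prop),
    intervalIntegral.integral_add (by apply Continuous.intervalIntegrable; fun_prop)
      (by apply Continuous.intervalIntegrable; fun_prop),
    intervalIntegral.integral_const_mul, intervalIntegral.integral_mul_const,
    intervalIntegral.integral_const_mul, ← e3] at e4
  rw [e2, e1]
  have e5 := hu₀ n
  set V := ∫ τ in (0 : ℝ)..t, ∫ z in (0 : ℝ)..1, v τ z * sinMode n z
  field_simp
  linear_combination e5 + e4

theorem exists_isClassicalSolution
    {p c q a k : ℝ} {b : ℝ → ℝ → ℝ} (hp : 0 < p) (hc : 0 < c)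
    (hb : ContinuousOn (fun x : ℝ × ℝ => b x.1 x.2) (Icc 0 1 ×ˢ Icc 0 1))
    {u₁₀ u₂₀ : ℝ → ℝ} (hu₁₀ : u₁₀ ∈ domainD q) (hu₂₀ : ContDiffOn ℝ 1 u₂₀ (Icc 0 1))
    (hcompat₀ : u₂₀ 0 = k * u₁₀ 1) {w θ₁₀ : ℝ → ℝ} (hw : MemL2 w) (hu₁₀w : HasWeakDeriv 2 u₁₀ w)
    (hθ₁₀_eq : ∀ᵐ z ∂(volume.restrict (Ioo (0 : ℝ) 1)),
      θ₁₀ z = p * w z + a * u₁₀ z + ∫ s in (0 : ℝ)..1, b z s * u₂₀ s)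
    (hθ₁₀ : θ₁₀ ∈ domainD q)
    (hcompat₁ : derivWithin u₂₀ (Icc 0 1) 0 = -c⁻¹ * k * θ₁₀ 1) :
    ∃ u₁ u₂ : ℝ → ℝ → ℝ, IsClassicalSolution p c q a k b u₁₀ u₂₀ u₁ u₂ := by
  obtain ⟨-, hu1, hu0, hu1q⟩ := hu₁₀
  obtain ⟨⟨-, hθw⟩, hθ1, hθ0, -⟩ := hθ₁₀
  obtain ⟨g, hg, hθg⟩ := hθw 2 le_rfl
  -- the kernel extended to the plane
  let B : ℝ → ℝ → ℝ := fun z s => b (clamp z) (clamp s)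
  have hB : Continuous ↿B := hb.comp_continuous
    (by fun_prop : Continuous fun x : ℝ × ℝ => (clamp x.1, clamp x.2))
    fun x => ⟨clamp_mem _, clamp_mem _⟩
  have hBb : ∀ z ∈ Icc (0 : ℝ) 1, ∀ s ∈ Icc (0 : ℝ) 1, B z s = b z s := fun z hz s hs => by
    simp only [B, clamp_of_mem hz, clamp_of_mem hs]
  -- the part of the differentiated history that is prescribed by the initial profile
  set d := derivWithin u₂₀ (Icc 0 1) with hd
  have hdc := continuousOn_derivWithin hu₂₀
  let h₀ : ℝ → ℝ := fun τ => -c * d (clamp (-c * τ)) + c * d 0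
  have hh₀ : Continuous h₀ := by
    have := (continuous_comp_clamp hdc).comp (continuous_const_mul (-c))
    exact (continuous_const.mul this).add continuous_const
  have hh₀pos : ∀ τ ≥ 0, h₀ τ = 0 := fun τ hτ => by
    simp only [h₀, clamp_of_nonpos (show -c * τ ≤ 0 by nlinarith)]
    ring
  obtain ⟨m, hm⟩ := isCompact_Icc.exists_bound_of_continuousOn hdc
  have hm₀ : ∀ τ, |h₀ τ| ≤ c * m + c * m := fun τ => by
    refine (abs_add_le _ _).trans (add_le_add ?_ ?_)
    · rw [abs_mul, abs_neg, abs_of_pos hc]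
      exact mul_le_mul_of_nonneg_left (hm _ (clamp_mem _)) hc.le
    · rw [abs_mul, abs_of_pos hc]
      exact mul_le_mul_of_nonneg_left (hm 0 (by simp)) hc.le
  obtain ⟨v, hv, hvθ, hvn⟩ := exists_timeDeriv (q := q) (a := a) (k := k) hp hc hB hh₀ hm₀
    hθ1 hg hθg hθ0
  have c1 : Continuous fun τ => v τ 1 :=
    hv.comp (by fun_prop : Continuous fun τ : ℝ => (τ, (1 : ℝ)))
  set h := history k h₀ (fun t => v t 1) with hh
  have hhc : Continuous h := continuous_history hh₀ c1
  obtain ⟨H, hHt⟩ : ∃ H : ℝ → ℝ, ∀ τ, H τ = u₂₀ 0 + ∫ σ in (0 : ℝ)..τ, h σ :=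
    ⟨_, fun _ => rfl⟩
  have hH : ∀ τ, HasDerivAt H (h τ) τ := fun τ => by
    rw [funext hHt]
    exact (hhc.integral_hasStrictDerivAt 0 τ).hasDerivAt.const_add _
  have hHc : Continuous H := continuous_iff_continuousAt.2 fun τ => (hH τ).continuousAt
  have hH1 : ContDiff ℝ 1 H := by
    rw [contDiff_one_iff_deriv, show deriv H = h from funext fun τ => (hH τ).deriv]
    exact ⟨fun τ => (hH τ).differentiableAt, hhc⟩
  let u₁ : ℝ → ℝ → ℝ := fun t z => (u₁₀ ∘ clamp) z + ∫ τ in (0 : ℝ)..t, v τ z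
  let u₂ : ℝ → ℝ → ℝ := fun t z => H (t - z / c)
  have hu0c : Continuous (u₁₀ ∘ clamp) := continuous_comp_clamp hu1.continuousOn
  have hu0e : ∀ z ∈ Icc (0 : ℝ) 1, (u₁₀ ∘ clamp) z = u₁₀ z := fun z hz => by
    rw [Function.comp_apply, clamp_of_mem hz]
  -- before time zero the history reproduces the initial profile
  have hHneg : ∀ s ∈ Icc (0 : ℝ) 1, H (0 - s / c) = u₂₀ s := by
    have hcst := constant_of_has_deriv_right_zero (f := fun s => H (0 - s / c) - u₂₀ s) (a := 0)
      (b := 1) ((by fun_prop : Continuous fun s => H (0 - s / c)).continuousOn.sub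
        hu₂₀.continuousOn) (fun s hs => by
      have hs' : s ∈ Icc (0 : ℝ) 1 := ⟨hs.1, hs.2.le⟩
      have e1 : HasDerivAt (fun s => H (0 - s / c)) (h (0 - s / c) * -(1 / c)) s :=
        (hH (0 - s / c)).comp s (((hasDerivAt_id s).div_const c).const_sub 0)
      have e2 := (hasDerivWithinAt_of_contDiffOn hu₂₀ hs').mono_of_mem_nhdsWithin
        (Icc_mem_nhdsGE_of_mem hs)
      have hsc : 0 ≤ s / c := div_nonneg hs.1 hc.le
      have e3 : h (0 - s / c) = -c * d s := by
        have : -c * (0 - s / c) = s := by field_simp; ring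
        simp only [hh, history, h₀, this, clamp_of_mem hs',
          max_eq_right (show 0 - s / c ≤ 0 by linarith)]
        rw [hvθ 1 (by simp), hcompat₁]
        field_simp
        ring
      refine (e1.hasDerivWithinAt.sub e2).congr_deriv ?_
      rw [e3, ← hd]
      field_simp
      ring)
    intro s hs
    have := hcst s hs
    rw [zero_div, sub_zero, hHt 0, intervalIntegral.integral_same, add_zero, sub_self] at this
    linarith
  -- after time zero the history is the boundary value of the parabolic component
  have hHpos : ∀ t ≥ 0, H t = k * u₁ t 1 := fun t ht => by
    have : ∫ σ in (0 : ℝ)..t, h σ = ∫ σ in (0 : ℝ)..t, k * v σ 1 := by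
      refine intervalIntegral.integral_congr fun σ hσ => ?_
      rw [uIcc_of_le ht] at hσ
      simp only [hh, history, hh₀pos σ hσ.1, max_eq_left hσ.1, add_zero]
    simp only [hHt, u₁, this, hu0e 1 (by simp), hcompat₀]
    rw [intervalIntegral.integral_const_mul]
    ring
  have hsrc : ∀ t, ∀ z ∈ Icc (0 : ℝ) 1, source c B H t z = ∫ s in (0 : ℝ)..1, b z s * u₂ t s := by
    intro t z hz
    refine intervalIntegral.integral_congr fun s hs => ?_
    rw [uIcc_of_le zero_le_one] at hs
    simp only [u₂, hBb z hz s hs]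
  have hu₀n : ∀ n, p * freq n ^ 2 * (∫ z in (0 : ℝ)..1, (u₁₀ ∘ clamp) z * sinMode n z)
      = p * q * (u₁₀ ∘ clamp) 1 * (-1) ^ n - (∫ z in (0 : ℝ)..1, θ₁₀ z * sinMode n z)
        + a * (∫ z in (0 : ℝ)..1, (u₁₀ ∘ clamp) z * sinMode n z)
        + ∫ z in (0 : ℝ)..1, source c B H 0 z * sinMode n z := by
    intro n
    have e1 : ∫ z in (0 : ℝ)..1, (u₁₀ ∘ clamp) z * sinMode n z
        = ∫ z in (0 : ℝ)..1, u₁₀ z * sinMode n z :=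
      intervalIntegral.integral_congr fun z hz => by
        rw [uIcc_of_le zero_le_one] at hz
        simp only [hu0e z hz]
    have e2 := freq_sq_mul_integral_mul_sinMode hu1 hw hu₁₀w hu0 n
    have hs0 : Continuous (source c B H 0) :=
      (continuous_source c hB hHc).comp (by fun_prop : Continuous fun z : ℝ => ((0 : ℝ), z))
    have iw : IntervalIntegrable (fun z => p * (w z * sinMode n z)) volume 0 1 :=
      (hw.intervalIntegrable.mul_continuousOn (continuous_sinMode n).continuousOn).const_mul p
    have iu : IntervalIntegrable (fun z => a * ((u₁₀ ∘ clamp) z * sinMode n z)) volume 0 1 :=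
      ((hu0c.mul (continuous_sinMode n)).const_mul a).intervalIntegrable _ _
    have e3 : ∫ z in (0 : ℝ)..1, θ₁₀ z * sinMode n z
        = ∫ z in (0 : ℝ)..1, (p * (w z * sinMode n z) + a * ((u₁₀ ∘ clamp) z * sinMode n z)
          + source c B H 0 z * sinMode n z) := by
      rw [intervalIntegral.integral_of_le zero_le_one, intervalIntegral.integral_of_le zero_le_one,
        ← restrict_Ioo_eq_restrict_Ioc]
      refine integral_congr_ae ?_
      filter_upwards [hθ₁₀_eq, ae_restrict_mem measurableSet_Ioo] with z hz hz'
      have hzI := Ioo_subset_Icc_self hz'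
      have : source c B H 0 z = ∫ s in (0 : ℝ)..1, b z s * u₂₀ s :=
        intervalIntegral.integral_congr fun s hs => by
          rw [uIcc_of_le zero_le_one] at hs
          simp only [hBb z hzI s hs, hHneg s hs]
      rw [hz, this, hu0e z hzI]
      ring
    have is : IntervalIntegrable (fun z => source c B H 0 z * sinMode n z) volume 0 1 :=
      (hs0.mul (continuous_sinMode n)).intervalIntegrable _ _
    rw [e3, intervalIntegral.integral_add (iw.add iu) is,
      intervalIntegral.integral_add iw iu, intervalIntegral.integral_const_mul,
      intervalIntegral.integral_const_mul, e1, hu0e 1 (by simp)]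
    linear_combination p * e2 + p * (-1) ^ n * hu1q
  have hell := add_integral_eq_ellipticSol hp hB hhc hH hu0c hv hu₀n hvn
  let f : ℝ → ℝ → ℝ := fun t z => (a * u₁ t z + source c B H t z - v t z) / p
  have hu₁c : Continuous ↿u₁ := continuous_add_integral hu0c hv
  have hfc : Continuous ↿f :=
    (((continuous_const.mul hu₁c).add (continuous_source c hB hHc)).sub hv).div_const p
  have hft : ∀ t, Continuous (f t) := fun t =>
    hfc.comp (by fun_prop : Continuous fun z : ℝ => (t, z))
  have hE : ∀ t ≥ 0, EqOn (u₁ t) (ellipticSol (f t) (q * u₁ t 1)) (Icc 0 1) := hell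
  have hvz : ∀ z, Continuous fun τ => v τ z := fun z =>
    hv.comp (by fun_prop : Continuous fun τ : ℝ => (τ, z))
  have hC1 : ContDiffOn ℝ 1 (fun x : ℝ × ℝ => u₁ x.1 x.2) (Ici 0 ×ˢ Icc 0 1) := by
    have hu11 : Continuous fun t => u₁ t 1 :=
      hu₁c.comp (by fun_prop : Continuous fun t : ℝ => (t, (1 : ℝ)))
    have hG : Continuous ↿(fun t z => q * u₁ t 1 + ∫ σ in z..1, f t σ) := by
      have h1 : Continuous fun x : ℝ × ℝ => ∫ σ in (1 : ℝ)..x.2, f x.1 σ :=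
        intervalIntegral.continuous_parametric_intervalIntegral_of_continuous (μ := volume)
          (f := fun (x : ℝ × ℝ) σ => f x.1 σ)
          (hfc.comp (by fun_prop : Continuous fun y : (ℝ × ℝ) × ℝ => (y.1.1, y.2)))
          continuous_snd
      have h2 : Continuous fun x : ℝ × ℝ => q * u₁ x.1 1 + -∫ σ in (1 : ℝ)..x.2, f x.1 σ := by
        fun_prop
      refine h2.congr fun x => ?_
      rw [← intervalIntegral.integral_symm]
      rfl
    refine contDiffOn_of_eq_integral (uniqueDiffOn_Ici 0) (uniqueDiffOn_Icc zero_lt_one) hv hG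
      (fun t _ t' _ z _ => ?_) fun t ht z hz z' hz' => ?_
    · simp only [u₁, add_sub_add_left_eq_sub]
      exact intervalIntegral.integral_interval_sub_left ((hvz z).intervalIntegrable _ _)
        ((hvz z).intervalIntegrable _ _)
    · rw [hE t ht hz, hE t ht hz']
      refine (intervalIntegral.integral_eq_sub_of_hasDerivAt
        (fun s _ => hasDerivAt_ellipticSol (hft t) _ s) ?_).symm
      have := hft t
      apply Continuous.intervalIntegrable; fun_prop
  refine ⟨u₁, u₂, ?_⟩
  exact
  { continuousOn_fst := hC1.continuousOn
    contDiffOn_fst := hC1.mono (prod_mono Ioi_subset_Ici_self subset_rfl)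
    contDiffOn_profile := fun t ht =>
      (contDiff_ellipticSol (hft t) _).1.contDiffOn.congr (hE t (le_of_lt ht))
    contDiffOn_snd := by
      have : ContDiff ℝ 1 fun x : ℝ × ℝ => H (x.1 - x.2 / c) :=
        hH1.comp (contDiff_fst.sub (contDiff_snd.div_const c))
      exact this.contDiffOn
    parabolic := fun t ht z hz => by
      have hzI := Ioo_subset_Icc_self hz
      have e1 : deriv (fun τ => u₁ τ z) t = v t z :=
        (((hvz z).integral_hasStrictDerivAt 0 t).hasDerivAt.const_add _).deriv
      have e2 : iteratedDeriv 2 (u₁ t) z = -f t z := by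
        have : u₁ t =ᶠ[nhds z] ellipticSol (f t) (q * u₁ t 1) :=
          Filter.eventually_of_mem (Icc_mem_nhds hz.1 hz.2) (hE t (le_of_lt ht))
        rw [this.iteratedDeriv_eq, (contDiff_ellipticSol (hft t) _).2, Pi.neg_apply]
      rw [e1, e2, ← hsrc t z hzI]
      simp only [f]
      field_simp
      ring
    transport := fun t _ z _ => by
      have e1 : HasDerivAt (fun τ => u₂ τ z) (h (t - z / c)) t :=
        (hH (t - z / c)).comp_sub_const t (z / c)
      have e2 : HasDerivAt (u₂ t) (h (t - z / c) * -(1 / c)) z :=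
        (hH (t - z / c)).comp z (((hasDerivAt_id z).div_const c).const_sub t)
      rw [e1.deriv, e2.deriv]
      field_simp
      ring
    boundary_left := fun t ht => by
      rw [hE t ht (by simp)]
      simp [ellipticSol]
    boundary_right := fun t ht => by
      have e1 := (hasDerivAt_ellipticSol (hft t) (q * u₁ t 1) 1).hasDerivWithinAt (s := Icc 0 1)
      have e2 := (e1.congr (hE t ht) (hE t ht (by simp))).derivWithin
        (uniqueDiffOn_Icc zero_lt_one 1 (by simp))
      rw [e2]
      simp
    boundary_loop := fun t ht => by
      simp only [u₂, zero_div, sub_zero]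
      exact hHpos t ht
    initial_fst := fun z hz => by
      simp only [u₁, intervalIntegral.integral_same, add_zero]
      exact hu0e z hz
    initial_snd := hHneg }

/-! ### Uniqueness -/

lemma hasDerivAt_time_of_contDiffOn {f : ℝ × ℝ → ℝ} (hf : ContDiffOn ℝ 1 f (Ioi 0 ×ˢ Icc 0 1))
    {t z : ℝ} (ht : 0 < t) (hz : z ∈ Icc (0 : ℝ) 1) :
    HasDerivAt (fun τ => f (τ, z)) (fderivWithin ℝ f (Ioi 0 ×ˢ Icc 0 1) (t, z) (1, 0)) t := by
  have h1 := (hf.differentiableOn one_ne_zero (t, z) ⟨ht, hz⟩).hasFDerivWithinAt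
  have h2 : HasDerivAt (fun τ : ℝ => (τ, z)) (1, 0) t :=
    (hasDerivAt_id t).prodMk (hasDerivAt_const t z)
  refine h1.comp_hasDerivAt t h2 ?_
  filter_upwards [Ioi_mem_nhds ht] with τ hτ
  exact ⟨hτ, hz⟩

lemma contDiffOn_slice_of_contDiffOn {f : ℝ × ℝ → ℝ} (hf : ContDiffOn ℝ 1 f (Ioi 0 ×ˢ Icc 0 1))
    {t : ℝ} (ht : 0 < t) : ContDiffOn ℝ 1 (fun z => f (t, z)) (Icc 0 1) :=
  hf.comp (contDiff_const.prodMk contDiff_id).contDiffOn fun _ hz => ⟨ht, hz⟩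

lemma differentiableAt_of_contDiffOn {f : ℝ → ℝ} (hf : ContDiffOn ℝ 1 f (Icc 0 1)) {z : ℝ}
    (hz : z ∈ Ioo (0 : ℝ) 1) : DifferentiableAt ℝ f z :=
  (hf.differentiableOn one_ne_zero z (Ioo_subset_Icc_self hz)).differentiableAt
    (Icc_mem_nhds hz.1 hz.2)

lemma hasDerivAt_integral_of_contDiffOn {f : ℝ × ℝ → ℝ}
    (hf : ContDiffOn ℝ 1 f (Ioi 0 ×ˢ Icc 0 1)) {t : ℝ} (ht : 0 < t) :
    IntervalIntegrable (fun z => deriv (fun τ => f (τ, z)) t) volume 0 1 ∧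
      HasDerivAt (fun t => ∫ z in (0 : ℝ)..1, f (t, z))
        (∫ z in (0 : ℝ)..1, deriv (fun τ => f (τ, z)) t) t := by
  set S : Set (ℝ × ℝ) := Ioi 0 ×ˢ Icc 0 1
  have hU : UniqueDiffOn ℝ S := (uniqueDiffOn_Ioi 0).prod (uniqueDiffOn_Icc zero_lt_one)
  have hD : ContinuousOn (fun x => fderivWithin ℝ f S x (1, 0)) S :=
    (hf.continuousOn_fderivWithin hU le_rfl).clm_apply continuousOn_const
  have hK : Icc (t / 2) (2 * t) ×ˢ Icc (0 : ℝ) 1 ⊆ S :=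
    prod_mono (fun τ hτ => lt_of_lt_of_le (half_pos ht) hτ.1) subset_rfl
  obtain ⟨M, hM⟩ := (isCompact_Icc.prod isCompact_Icc).exists_bound_of_continuousOn (hD.mono hK)
  have hslice : ∀ {g : ℝ × ℝ → ℝ}, ContinuousOn g S → ∀ τ > 0,
      IntervalIntegrable (fun z => g (τ, z)) volume 0 1 := fun hg τ hτ => by
    apply ContinuousOn.intervalIntegrable
    rw [uIcc_of_le zero_le_one]
    exact hg.comp (by fun_prop) fun z hz => ⟨hτ, hz⟩
  have hmain := intervalIntegral.hasDerivAt_integral_of_dominated_loc_of_deriv_le (μ := volume)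
    (a := 0) (b := 1)
    (F := fun τ z => f (τ, z)) (F' := fun τ z => fderivWithin ℝ f S (τ, z) (1, 0)) (x₀ := t)
    (s := Icc (t / 2) (2 * t)) (bound := fun _ => M)
    (Icc_mem_nhds (by linarith) (by linarith))
    (by
      filter_upwards [Ioi_mem_nhds ht] with τ hτ
      have := (hslice hf.continuousOn τ hτ).aestronglyMeasurable
      rwa [uIoc_of_le zero_le_one])
    (hslice hf.continuousOn t ht)
    (by
      have := (hslice hD t ht).aestronglyMeasurable
      rwa [uIoc_of_le zero_le_one])
    (Filter.Eventually.of_forall fun z hz τ hτ => hM (τ, z) ⟨hτ, by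
      rw [uIoc_of_le zero_le_one] at hz; exact Ioc_subset_Icc_self hz⟩)
    (by simp)
    (Filter.Eventually.of_forall fun z hz τ hτ =>
      hasDerivAt_time_of_contDiffOn hf (lt_of_lt_of_le (half_pos ht) hτ.1) (by
        rw [uIoc_of_le zero_le_one] at hz; exact Ioc_subset_Icc_self hz))
  have he : EqOn (fun z => fderivWithin ℝ f S (t, z) (1, 0))
      (fun z => deriv (fun τ => f (τ, z)) t) (uIcc 0 1) := fun z hz => by
    rw [uIcc_of_le zero_le_one] at hz
    exact (hasDerivAt_time_of_contDiffOn hf ht hz).deriv.symm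
  rw [intervalIntegral.integral_congr he] at hmain
  exact ⟨hmain.1.congr (he.mono uIoc_subset_uIcc), hmain.2⟩

lemma intervalIntegrable_of_continuousOn_Icc {f : ℝ → ℝ} (hf : ContinuousOn f (Icc 0 1)) :
    IntervalIntegrable f volume 0 1 :=
  ContinuousOn.intervalIntegrable (by rwa [uIcc_of_le zero_le_one])

lemma sq_integral_le {g : ℝ → ℝ} (hg : ContinuousOn g (Icc 0 1)) :
    (∫ z in (0 : ℝ)..1, g z) ^ 2 ≤ ∫ z in (0 : ℝ)..1, g z ^ 2 := by
  set m := ∫ z in (0 : ℝ)..1, g z with hm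
  have h0 : 0 ≤ ∫ z in (0 : ℝ)..1, (g z - m) ^ 2 :=
    intervalIntegral.integral_nonneg zero_le_one fun z _ => sq_nonneg _
  have i1 := intervalIntegrable_of_continuousOn_Icc hg
  have i2 : IntervalIntegrable (fun z => g z ^ 2) volume 0 1 :=
    intervalIntegrable_of_continuousOn_Icc (hg.pow 2)
  have e : ∀ z, (g z - m) ^ 2 = g z ^ 2 - 2 * m * g z + m ^ 2 := fun z => by ring
  simp_rw [e] at h0
  rw [intervalIntegral.integral_add (i2.sub (i1.const_mul _)) (by simp),
    intervalIntegral.integral_sub i2 (i1.const_mul _), intervalIntegral.integral_const_mul,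
    ← hm] at h0
  simp at h0
  linarith

lemma IsClassicalSolution.sub {p c q a k : ℝ} {b : ℝ → ℝ → ℝ} {u₁₀ u₂₀ : ℝ → ℝ}
    {u₁ u₂ v₁ v₂ : ℝ → ℝ → ℝ}
    (hb : ContinuousOn (fun x : ℝ × ℝ => b x.1 x.2) (Icc 0 1 ×ˢ Icc 0 1))
    (hu : IsClassicalSolution p c q a k b u₁₀ u₂₀ u₁ u₂)
    (hv : IsClassicalSolution p c q a k b u₁₀ u₂₀ v₁ v₂) :
    IsClassicalSolution p c q a k b 0 0 (fun t z => u₁ t z - v₁ t z)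
      (fun t z => u₂ t z - v₂ t z) := by
  have hS : Ioi (0 : ℝ) ×ˢ Icc (0 : ℝ) 1 ⊆ Ici 0 ×ˢ Icc 0 1 :=
    prod_mono Ioi_subset_Ici_self subset_rfl
  have dt : ∀ {f : ℝ → ℝ → ℝ}, ContDiffOn ℝ 1 (fun x : ℝ × ℝ => f x.1 x.2) (Ioi 0 ×ˢ Icc 0 1) →
      ∀ t > 0, ∀ z ∈ Ioo (0 : ℝ) 1, DifferentiableAt ℝ (fun τ => f τ z) t :=
    fun hf t ht z hz =>
      (hasDerivAt_time_of_contDiffOn hf ht (Ioo_subset_Icc_self hz)).differentiableAt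
  exact
  { continuousOn_fst := hu.continuousOn_fst.sub hv.continuousOn_fst
    contDiffOn_fst := hu.contDiffOn_fst.sub hv.contDiffOn_fst
    contDiffOn_profile := fun t ht => (hu.contDiffOn_profile t ht).sub (hv.contDiffOn_profile t ht)
    contDiffOn_snd := hu.contDiffOn_snd.sub hv.contDiffOn_snd
    parabolic := fun t ht z hz => by
      have h1 := hu.parabolic t ht z hz
      have h2 := hv.parabolic t ht z hz
      have hzI := Ioo_subset_Icc_self hz
      have e1 : deriv (fun τ => u₁ τ z - v₁ τ z) t
          = deriv (fun τ => u₁ τ z) t - deriv (fun τ => v₁ τ z) t :=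
        deriv_fun_sub (dt hu.contDiffOn_fst t ht z hz) (dt hv.contDiffOn_fst t ht z hz)
      have e2 : iteratedDeriv 2 (fun z => u₁ t z - v₁ t z) z
          = iteratedDeriv 2 (u₁ t) z - iteratedDeriv 2 (v₁ t) z :=
        iteratedDeriv_fun_sub ((hu.contDiffOn_profile t ht).contDiffAt (Icc_mem_nhds hz.1 hz.2))
          ((hv.contDiffOn_profile t ht).contDiffAt (Icc_mem_nhds hz.1 hz.2))
      have hbz : ContinuousOn (b z) (Icc 0 1) :=
        hb.comp (f := fun s => (z, s)) (by fun_prop) fun s hs => ⟨hzI, hs⟩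
      have cu : ContinuousOn (u₂ t) (Icc 0 1) :=
        hu.contDiffOn_snd.continuousOn.comp (f := fun s => (t, s)) (by fun_prop)
          fun s hs => ⟨le_of_lt ht, hs⟩
      have cv : ContinuousOn (v₂ t) (Icc 0 1) :=
        hv.contDiffOn_snd.continuousOn.comp (f := fun s => (t, s)) (by fun_prop)
          fun s hs => ⟨le_of_lt ht, hs⟩
      have e3 : ∫ s in (0 : ℝ)..1, b z s * (u₂ t s - v₂ t s)
          = (∫ s in (0 : ℝ)..1, b z s * u₂ t s) - ∫ s in (0 : ℝ)..1, b z s * v₂ t s := by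
        simp_rw [mul_sub]
        exact intervalIntegral.integral_sub (intervalIntegrable_of_continuousOn_Icc (hbz.mul cu))
          (intervalIntegrable_of_continuousOn_Icc (hbz.mul cv))
      rw [e1, e2, e3]
      linear_combination h1 - h2
    transport := fun t ht z hz => by
      have h1 := hu.transport t ht z hz
      have h2 := hv.transport t ht z hz
      have cu := hu.contDiffOn_snd.mono hS
      have cv := hv.contDiffOn_snd.mono hS
      have e1 : deriv (fun τ => u₂ τ z - v₂ τ z) t
          = deriv (fun τ => u₂ τ z) t - deriv (fun τ => v₂ τ z) t :=
        deriv_fun_sub (dt cu t ht z hz) (dt cv t ht z hz)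
      have e2 : deriv (fun z => u₂ t z - v₂ t z) z = deriv (u₂ t) z - deriv (v₂ t) z :=
        deriv_fun_sub (differentiableAt_of_contDiffOn (contDiffOn_slice_of_contDiffOn cu ht) hz)
          (differentiableAt_of_contDiffOn (contDiffOn_slice_of_contDiffOn cv ht) hz)
      rw [e1, e2]
      linear_combination h1 - h2
    boundary_left := fun t ht => by simp [hu.boundary_left t ht, hv.boundary_left t ht]
    boundary_right := fun t ht => by
      have h1 : (1 : ℝ) ∈ Icc (0 : ℝ) 1 := by simp
      rcases eq_or_lt_of_le ht with rfl | ht'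
      -- at the initial time both profiles coincide, and no differentiability is needed
      · have h0 : EqOn (fun z => u₁ 0 z - v₁ 0 z) (fun _ => 0) (Icc 0 1) := fun z hz => by
          simp [hu.initial_fst z hz, hv.initial_fst z hz]
        rw [derivWithin_congr h0 (h0 h1), hu.initial_fst 1 h1, hv.initial_fst 1 h1]
        simp
      · have d := fun {f : ℝ → ℝ} (hf : ContDiffOn ℝ 2 f (Icc 0 1)) =>
          hf.differentiableOn two_ne_zero 1 h1
        rw [derivWithin_fun_sub (d (hu.contDiffOn_profile t ht')) (d (hv.contDiffOn_profile t ht'))]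
        linear_combination hu.boundary_right t ht - hv.boundary_right t ht
    boundary_loop := fun t ht => by
      linear_combination hu.boundary_loop t ht - hv.boundary_loop t ht
    initial_fst := fun z hz => by simp [hu.initial_fst z hz, hv.initial_fst z hz]
    initial_snd := fun z hz => by simp [hu.initial_snd z hz, hv.initial_snd z hz] }


/-- The dissipation estimate for homogeneous data: the flux through `z = 1` produced by the Robin
condition and by the loop is absorbed by the diffusion because `q < 1`. -/
lemma IsClassicalSolution.integral_deriv_energy_le {p c q a k M ε : ℝ} {b u₁ u₂ : ℝ → ℝ → ℝ}
    {u₁₀ u₂₀ : ℝ → ℝ} (hp : 0 < p) (hc : 0 < c) (hε : 0 < ε)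
    (hεk : ε * c * k ^ 2 ≤ 2 * p * (1 - q))
    (hM : ∀ z ∈ Icc (0 : ℝ) 1, ∀ s ∈ Icc (0 : ℝ) 1, |b z s| ≤ M)
    (hu : IsClassicalSolution p c q a k b u₁₀ u₂₀ u₁ u₂) {t : ℝ} (ht : 0 < t) :
    ∫ z in (0 : ℝ)..1, deriv (fun τ => u₁ τ z ^ 2 + ε * u₂ τ z ^ 2) t
      ≤ (2 * |a| + M + M / ε) * ∫ z in (0 : ℝ)..1, (u₁ t z ^ 2 + ε * u₂ t z ^ 2) := by
  have hM0 : 0 ≤ M := (abs_nonneg _).trans (hM 0 (by simp) 0 (by simp))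
  have hcu₂ : ContDiffOn ℝ 1 (fun x : ℝ × ℝ => u₂ x.1 x.2) (Ioi 0 ×ˢ Icc 0 1) :=
    hu.contDiffOn_snd.mono (prod_mono Ioi_subset_Ici_self subset_rfl)
  set φ := u₁ t with hφ
  set ψ := u₂ t with hψ
  have hφ2 : ContDiffOn ℝ 2 φ (Icc 0 1) := hu.contDiffOn_profile t ht
  have hφ1 : ContDiffOn ℝ 1 φ (Icc 0 1) := hφ2.of_le (by norm_num)
  have hψ1 : ContDiffOn ℝ 1 ψ (Icc 0 1) := contDiffOn_slice_of_contDiffOn hcu₂ ht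
  set φ' := derivWithin φ (Icc 0 1) with hφ'
  have hφ'1 : ContDiffOn ℝ 1 φ' (Icc 0 1) :=
    hφ2.derivWithin (uniqueDiffOn_Icc zero_lt_one) (by norm_num)
  set φ'' := derivWithin φ' (Icc 0 1) with hφ''
  set ψ' := derivWithin ψ (Icc 0 1) with hψ'
  have cφ := hφ1.continuousOn
  have cψ := hψ1.continuousOn
  have cφ' : ContinuousOn φ' (Icc 0 1) := hφ'1.continuousOn
  have cφ'' : ContinuousOn φ'' (Icc 0 1) := continuousOn_derivWithin hφ'1
  have cψ' : ContinuousOn ψ' (Icc 0 1) := continuousOn_derivWithin hψ1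
  have ii : ∀ {f : ℝ → ℝ}, ContinuousOn f (Icc 0 1) → IntervalIntegrable f volume 0 1 :=
    fun hf => intervalIntegrable_of_continuousOn_Icc hf
  set J := ∫ s in (0 : ℝ)..1, ψ s ^ 2 with hJ
  set N := ∫ z in (0 : ℝ)..1, φ z ^ 2 with hN
  have hJ0 : 0 ≤ J := intervalIntegral.integral_nonneg zero_le_one fun _ _ => sq_nonneg _
  have hN0 : 0 ≤ N := intervalIntegral.integral_nonneg zero_le_one fun _ _ => sq_nonneg _
  have hA : (∫ s in (0 : ℝ)..1, |ψ s|) ^ 2 ≤ J := by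
    have := sq_integral_le cψ.abs
    simpa only [Pi.abs_apply, sq_abs] using this
  have hA0 : 0 ≤ ∫ s in (0 : ℝ)..1, |ψ s| :=
    intervalIntegral.integral_nonneg zero_le_one fun _ _ => abs_nonneg _
  have d0 : ∀ {g : ℝ → ℝ}, ∀ z ∈ Ioo (0 : ℝ) 1, deriv g z = derivWithin g (Icc 0 1) z :=
    fun {g} z hz => (derivWithin_of_mem_nhds (Icc_mem_nhds hz.1 hz.2)).symm
  -- the pointwise bound from the equations and Young's inequality
  have hpt : ∀ z ∈ Ioo (0 : ℝ) 1, deriv (fun τ => u₁ τ z ^ 2 + ε * u₂ τ z ^ 2) t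
      ≤ 2 * p * (φ z * φ'' z) + (2 * |a| + M) * φ z ^ 2 + M * J - 2 * ε * c * (ψ z * ψ' z) := by
    intro z hz
    have hzI := Ioo_subset_Icc_self hz
    have h1 := (hasDerivAt_time_of_contDiffOn hu.contDiffOn_fst ht hzI).differentiableAt.hasDerivAt
    have h2 := (hasDerivAt_time_of_contDiffOn hcu₂ ht hzI).differentiableAt.hasDerivAt
    have e1 := ((h1.pow 2).add ((h2.pow 2).const_mul ε)).deriv
    have e2 := hu.parabolic t ht z hz
    have e3 := hu.transport t ht z hz
    have e4 : iteratedDeriv 2 φ z = φ'' z := by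
      rw [iteratedDeriv_succ, iteratedDeriv_one, hφ'']
      have : deriv φ =ᶠ[nhds z] φ' :=
        Filter.eventually_of_mem (Ioo_mem_nhds hz.1 hz.2) fun y hy => d0 y hy
      rw [this.deriv_eq, d0 z hz]
    rw [← hψ, d0 z hz, ← hψ'] at e3
    rw [← hφ, e4] at e2
    set F := ∫ s in (0 : ℝ)..1, b z s * u₂ t s with hF
    have hFle : |F| ≤ M * ∫ s in (0 : ℝ)..1, |ψ s| := by
      rw [← intervalIntegral.integral_const_mul, ← Real.norm_eq_abs]
      refine intervalIntegral.norm_integral_le_of_norm_le zero_le_one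
        (Filter.Eventually.of_forall fun s hs => ?_) ((ii cψ.abs).const_mul M)
      rw [Real.norm_eq_abs, abs_mul]
      exact mul_le_mul_of_nonneg_right (hM z hzI s (Ioc_subset_Icc_self hs)) (abs_nonneg _)
    have hyoung : 2 * φ z * F ≤ M * (φ z ^ 2 + J) := by
      calc 2 * φ z * F ≤ 2 * |φ z| * |F| := by
            rw [mul_assoc, mul_assoc, ← abs_mul]; gcongr; exact le_abs_self _
        _ ≤ 2 * |φ z| * (M * ∫ s in (0 : ℝ)..1, |ψ s|) := by gcongr
        _ = M * (2 * |φ z| * ∫ s in (0 : ℝ)..1, |ψ s|) := by ring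
        _ ≤ M * (φ z ^ 2 + J) := by
            gcongr
            have := sq_nonneg (|φ z| - ∫ s in (0 : ℝ)..1, |ψ s|)
            rw [sub_sq, sq_abs] at this
            linarith
    have ha : a * φ z ^ 2 ≤ |a| * φ z ^ 2 :=
      mul_le_mul_of_nonneg_right (le_abs_self a) (sq_nonneg _)
    have e5 : deriv (fun τ => u₁ τ z ^ 2 + ε * u₂ τ z ^ 2) t
        = 2 * φ z * (p * φ'' z + a * φ z + F) + ε * (2 * ψ z * -(c * ψ' z)) := by
      have e6 : deriv (fun τ => u₁ τ z) t = p * φ'' z + a * φ z + F := by linarith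
      have e7 : deriv (fun τ => u₂ τ z) t = -(c * ψ' z) := by linarith
      rw [← e6, ← e7]
      refine Eq.trans e1 ?_
      simp only [hφ, hψ]
      push_cast
      ring
    rw [e5]
    nlinarith
  have hE : ContDiffOn ℝ 1 (fun x : ℝ × ℝ => u₁ x.1 x.2 ^ 2 + ε * u₂ x.1 x.2 ^ 2)
      (Ioi 0 ×ˢ Icc 0 1) :=
    (hu.contDiffOn_fst.pow 2).add (contDiffOn_const.mul (hcu₂.pow 2))
  have i1 : IntervalIntegrable (fun z => 2 * p * (φ z * φ'' z)) volume 0 1 :=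
    (ii (cφ.mul cφ'')).const_mul _
  have i2 : IntervalIntegrable (fun z => (2 * |a| + M) * φ z ^ 2) volume 0 1 :=
    (ii (cφ.pow 2)).const_mul _
  have i3 : IntervalIntegrable (fun _ : ℝ => M * J) volume 0 1 := by simp
  have i4 : IntervalIntegrable (fun z => 2 * ε * c * (ψ z * ψ' z)) volume 0 1 :=
    (ii (cψ.mul cψ')).const_mul _
  have hint := intervalIntegral.integral_mono_on_of_le_Ioo zero_le_one
    (hasDerivAt_integral_of_contDiffOn hE ht).1 (((i1.add i2).add i3).sub i4) hpt
  rw [intervalIntegral.integral_sub ((i1.add i2).add i3) i4,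
    intervalIntegral.integral_add (i1.add i2) i3, intervalIntegral.integral_add i1 i2,
    intervalIntegral.integral_const, intervalIntegral.integral_const_mul,
    intervalIntegral.integral_const_mul, intervalIntegral.integral_const_mul, ← hN] at hint
  have w : ∀ {f : ℝ → ℝ}, ContDiffOn ℝ 1 f (Icc 0 1) → ∀ z ∈ uIcc (0 : ℝ) 1,
      HasDerivWithinAt f (derivWithin f (Icc 0 1) z) (uIcc 0 1) z := fun hf z hz => by
    rw [uIcc_of_le zero_le_one] at hz ⊢
    exact hasDerivWithinAt_of_contDiffOn hf hz
  have hφ0 : φ 0 = 0 := hu.boundary_left t ht.le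
  have hφ1' : φ' 1 = q * φ 1 := sub_eq_zero.1 (hu.boundary_right t ht.le)
  have p1 : ∫ z in (0 : ℝ)..1, φ z * φ'' z = q * φ 1 ^ 2 - ∫ z in (0 : ℝ)..1, φ' z ^ 2 := by
    rw [intervalIntegral.integral_mul_deriv_eq_deriv_mul_of_hasDerivWithinAt (w hφ1) (w hφ'1)
      (ii cφ') (ii cφ''), hφ0, hφ1']
    simp_rw [← hφ', sq]
    ring
  have p2 : 2 * ∫ z in (0 : ℝ)..1, ψ z * ψ' z = ψ 1 ^ 2 - k ^ 2 * φ 1 ^ 2 := by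
    have h := intervalIntegral.integral_mul_deriv_eq_deriv_mul_of_hasDerivWithinAt (w hψ1) (w hψ1)
      (ii cψ') (ii cψ')
    have hcomm : ∫ z in (0 : ℝ)..1, derivWithin ψ (Icc 0 1) z * ψ z
        = ∫ z in (0 : ℝ)..1, ψ z * ψ' z := by simp_rw [← hψ', mul_comm]
    have hψ0 : ψ 0 = k * φ 1 := hu.boundary_loop t ht.le
    rw [hcomm, ← hψ', hψ0] at h
    linarith
  have p3 : φ 1 ^ 2 ≤ ∫ z in (0 : ℝ)..1, φ' z ^ 2 := by
    have : ∫ z in (0 : ℝ)..1, φ' z = φ 1 := by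
      rw [intervalIntegral.integral_eq_sub_of_hasDerivAt_of_le zero_le_one cφ
        (fun z hz => (w hφ1 z (by
          rw [uIcc_of_le zero_le_one]; exact Ioo_subset_Icc_self hz)).hasDerivAt (by
          rw [uIcc_of_le zero_le_one]; exact Icc_mem_nhds hz.1 hz.2)) (ii cφ'), hφ0, sub_zero]
    rw [← this]
    exact sq_integral_le cφ'
  have p4 : ∫ z in (0 : ℝ)..1, (u₁ t z ^ 2 + ε * u₂ t z ^ 2) = N + ε * J := by
    have iφ : IntervalIntegrable (fun z => φ z ^ 2) volume 0 1 := ii (cφ.pow 2)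
    have iψ : IntervalIntegrable (fun z => ε * ψ z ^ 2) volume 0 1 :=
      (ii (cψ.pow 2)).const_mul ε
    rw [intervalIntegral.integral_add iφ iψ, intervalIntegral.integral_const_mul]
  rw [p4]
  refine hint.trans ?_
  rw [p1]
  have f1 : ε * c * (k ^ 2 * φ 1 ^ 2) ≤ 2 * p * (1 - q) * φ 1 ^ 2 := by
    have := mul_le_mul_of_nonneg_right hεk (sq_nonneg (φ 1))
    linarith
  have f2 : 2 * p * (q * φ 1 ^ 2 - ∫ z in (0 : ℝ)..1, φ' z ^ 2)
      ≤ 2 * p * (q * φ 1 ^ 2 - φ 1 ^ 2) := by gcongr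
  have f3 : 0 ≤ ε * c * ψ 1 ^ 2 := by positivity
  have f4 : 2 * ε * c * ∫ z in (0 : ℝ)..1, ψ z * ψ' z
      = ε * c * ψ 1 ^ 2 - ε * c * (k ^ 2 * φ 1 ^ 2) := by
    linear_combination ε * c * p2
  have f5 : (2 * |a| + M + M / ε) * (N + ε * J)
      = (2 * |a| + M) * N + M * J + (2 * |a| + M) * (ε * J) + M / ε * N := by
    field_simp
    ring
  have f6 : 0 ≤ (2 * |a| + M) * (ε * J) := by positivity
  have f7 : 0 ≤ M / ε * N := by positivity
  rw [f4, f5]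
  simp only [sub_zero, one_smul]
  linarith

lemma IsClassicalSolution.eq_zero {p c q a k : ℝ} {b u₁ u₂ : ℝ → ℝ → ℝ} (hp : 0 < p) (hc : 0 < c)
    (hq : q < 1) (hb : ContinuousOn (fun x : ℝ × ℝ => b x.1 x.2) (Icc 0 1 ×ˢ Icc 0 1))
    (hu : IsClassicalSolution p c q a k b 0 0 u₁ u₂) :
    ∀ t ≥ 0, ∀ z ∈ Icc (0 : ℝ) 1, u₁ t z = 0 ∧ u₂ t z = 0 := by
  obtain ⟨M, hM⟩ : ∃ M, ∀ z ∈ Icc (0 : ℝ) 1, ∀ s ∈ Icc (0 : ℝ) 1, |b z s| ≤ M := by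
    obtain ⟨M, hM⟩ := (isCompact_Icc.prod isCompact_Icc).exists_bound_of_continuousOn hb
    exact ⟨M, fun z hz s hs => hM (z, s) ⟨hz, hs⟩⟩
  have hq' : 0 < 1 - q := by linarith
  obtain ⟨ε, hε, hεk⟩ : ∃ ε > 0, ε * c * k ^ 2 ≤ 2 * p * (1 - q) := by
    refine ⟨2 * p * (1 - q) / (c * (k ^ 2 + 1)), by positivity, ?_⟩
    rw [div_mul_eq_mul_div, div_mul_eq_mul_div, div_le_iff₀ (by positivity)]
    have : 0 ≤ 2 * p * (1 - q) * c := by positivity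
    linarith
  set C := 2 * |a| + M + M / ε
  set Q : ℝ × ℝ → ℝ := fun x => u₁ x.1 x.2 ^ 2 + ε * u₂ x.1 x.2 ^ 2 with hQ
  have cQ : ContinuousOn Q (Ici 0 ×ˢ Icc 0 1) :=
    (hu.continuousOn_fst.pow 2).add (continuousOn_const.mul (hu.contDiffOn_snd.continuousOn.pow 2))
  have hQ1 : ContDiffOn ℝ 1 Q (Ioi 0 ×ˢ Icc 0 1) :=
    (hu.contDiffOn_fst.pow 2).add (contDiffOn_const.mul ((hu.contDiffOn_snd.mono
      (prod_mono Ioi_subset_Ici_self subset_rfl)).pow 2))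
  set E : ℝ → ℝ := fun t => ∫ z in (0 : ℝ)..1, Q (t, z) with hE
  have cE : ContinuousOn E (Ici 0) := by
    have h1 : Continuous fun x : ℝ × ℝ => Q (max x.1 0, clamp x.2) :=
      cQ.comp_continuous (by fun_prop) fun x =>
        ⟨mem_Ici.2 (le_max_right _ _), clamp_mem _⟩
    have h2 : Continuous fun t => ∫ z in (0 : ℝ)..1, Q (max t 0, clamp z) :=
      intervalIntegral.continuous_parametric_intervalIntegral_of_continuous' (μ := volume)
        (f := fun t z => Q (max t 0, clamp z)) h1 0 1
    refine h2.continuousOn.congr fun t ht => intervalIntegral.integral_congr fun z hz => ?_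
    rw [uIcc_of_le zero_le_one] at hz
    simp only [max_eq_left (mem_Ici.1 ht), clamp_of_mem hz]
  have hdE : ∀ t > 0, HasDerivAt E (∫ z in (0 : ℝ)..1, deriv (fun τ => Q (τ, z)) t) t :=
    fun t ht => (hasDerivAt_integral_of_contDiffOn hQ1 ht).2
  have hle : ∀ t > 0, ∫ z in (0 : ℝ)..1, deriv (fun τ => Q (τ, z)) t ≤ C * E t :=
    fun t ht => hu.integral_deriv_energy_le hp hc hε hεk hM ht
  have hw : ∀ t > 0, HasDerivAt (fun t => Real.exp (-C * t) * E t)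
      (Real.exp (-C * t) * -C * E t
        + Real.exp (-C * t) * ∫ z in (0 : ℝ)..1, deriv (fun τ => Q (τ, z)) t) t :=
    fun t ht => (hasDerivAt_const_mul (-C)).exp.mul (hdE t ht)
  have hanti : AntitoneOn (fun t => Real.exp (-C * t) * E t) (Ici 0) := by
    refine antitoneOn_of_deriv_nonpos (convex_Ici 0) ((by fun_prop : Continuous fun t =>
      Real.exp (-C * t)).continuousOn.mul cE) (fun t ht => ?_) fun t ht => ?_
    · rw [interior_Ici] at ht
      exact (hw t ht).differentiableAt.differentiableWithinAt
    · rw [interior_Ici] at ht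
      rw [(hw t ht).deriv]
      have := mul_le_mul_of_nonneg_left (hle t ht) (Real.exp_pos (-C * t)).le
      linarith
  have hE0 : E 0 = 0 := by
    have : ∀ z ∈ uIcc (0 : ℝ) 1, Q (0, z) = 0 := fun z hz => by
      rw [uIcc_of_le zero_le_one] at hz
      simp [hQ, hu.initial_fst z hz, hu.initial_snd z hz]
    simp only [hE]
    rw [intervalIntegral.integral_congr this]
    simp
  intro t ht z hz
  have h1 : Real.exp (-C * t) * E t ≤ 0 := by
    have := hanti (mem_Ici.2 le_rfl) (mem_Ici.2 ht) ht
    simpa [hE0] using this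
  have h2 : E t ≤ 0 := nonpos_of_mul_nonpos_right h1 (Real.exp_pos _)
  have hQ0 : ∀ z, 0 ≤ Q (t, z) := fun z => by positivity
  have h3 : Q (t, z) = 0 := eq_zero_of_integral_eq_zero (f := fun z => Q (t, z))
    (cQ.comp (by fun_prop) fun z hz => ⟨ht, hz⟩) (fun z _ => hQ0 z) h2 z hz
  have h4 : 0 ≤ u₁ t z ^ 2 := sq_nonneg _
  have h5 : 0 ≤ ε * u₂ t z ^ 2 := by positivity
  simp only [hQ] at h3
  refine ⟨pow_eq_zero_iff two_ne_zero |>.1 (by linarith), ?_⟩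
  have h6 : ε * u₂ t z ^ 2 = 0 := by linarith
  exact pow_eq_zero_iff two_ne_zero |>.1 ((mul_eq_zero.1 h6).resolve_left hε.ne')

end ParabolicTransport

theorem theorem2p4
    (p c q a k : ℝ) (b : ℝ → ℝ → ℝ) (hp : 0 < p) (hc : 0 < c) (hq : q < 1)
    (hb : ContDiffOn ℝ 1 (fun x : ℝ × ℝ => b x.1 x.2) (Icc 0 1 ×ˢ Icc 0 1))
    -- `b₁` is the unique solution in `(-π/2, π/2)` of the first phase equation
    (b₁ : ℝ) (hb₁ : b₁ ∈ Ioo (-(Real.pi / 2)) (Real.pi / 2))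
    (hb₁q : (Real.pi / 2 - b₁) * Real.cot (Real.pi / 2 - b₁) = q)
    (hpos : 4 * a < p * (Real.pi - 2 * b₁) ^ 2)
    (u₁₀ u₂₀ : ℝ → ℝ)
    (hu₁₀ : u₁₀ ∈ ParabolicTransport.domainD q)
    (hu₂₀ : ContDiffOn ℝ 1 u₂₀ (Icc 0 1))
    (hcompat₀ : u₂₀ 0 = k * u₁₀ 1)
    -- `w` is the weak second derivative of `u₁₀`; `θ₁₀` is `p u₁₀'' + a u₁₀ + ∫ b(·,s) u₂₀(s) ds`
    (w θ₁₀ : ℝ → ℝ)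
    (hw : ParabolicTransport.MemL2 w) (hu₁₀w : ParabolicTransport.HasWeakDeriv 2 u₁₀ w)
    (hθ₁₀_eq : ∀ᵐ z ∂(volume.restrict (Ioo (0 : ℝ) 1)),
      θ₁₀ z = p * w z + a * u₁₀ z + ∫ s in (0 : ℝ)..1, b z s * u₂₀ s)
    (hθ₁₀ : θ₁₀ ∈ ParabolicTransport.domainD q)
    (hcompat₁ : derivWithin u₂₀ (Icc 0 1) 0 = -c⁻¹ * k * θ₁₀ 1) :
    ∃ u₁ u₂ : ℝ → ℝ → ℝ,
      ParabolicTransport.IsClassicalSolution p c q a k b u₁₀ u₂₀ u₁ u₂ ∧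
      ∀ v₁ v₂ : ℝ → ℝ → ℝ,
        ParabolicTransport.IsClassicalSolution p c q a k b u₁₀ u₂₀ v₁ v₂ →
        ∀ t ≥ 0, ∀ z ∈ Icc (0 : ℝ) 1, v₁ t z = u₁ t z ∧ v₂ t z = u₂ t z := by
  have hbc := hb.continuousOn
  obtain ⟨u₁, u₂, hu⟩ := ParabolicTransport.exists_isClassicalSolution hp hc hbc hu₁₀ hu₂₀
    hcompat₀ hw hu₁₀w hθ₁₀_eq hθ₁₀ hcompat₁
  refine ⟨u₁, u₂, hu, fun v₁ v₂ hv t ht z hz => ?_⟩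
  have h := (hv.sub hbc hu).eq_zero hp hc hq hbc t ht z hz
  exact ⟨sub_eq_zero.1 h.1, sub_eq_zero.1 h.2⟩
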